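/- **Setting.** Let $d\ge 1$ and $N$ be natural numbers and let $D,B,P,\sigma>0$ be reals; put $\mathtt{SNR}=P/\sigma^2$. Write $\log$ for the logarithm to base $2$ and $\|\cdot\|$ for the Euclidean norm. *Oracles.* Let $\mathcal X\subset\mathbb R^d$ be a nonempty closed convex set with $\sup_{x,y\in\mathcal X}\|x-y\|\le D$. Let $\mathcal O$ be the set of pairs $(f,O)$ of a convex function $f:\mathcal X\to\mathbb R$ and a first-order oracle $O$ that answers each query $x\in\mathcal X$, with fresh independent randomness, by a random vector $\hat g(x)\in\mathbb R^d$ with $\mathbb E[\hat g(x)]\in\partial f(x)$ and $\mathbb E\|\hat g(x)\|^2\le B^2$, where $\partial f(x)=\{g: f(y)\ge f(x)+\langle g,y-x\rangle\ \forall y\in\mathcal X\}$. *Protocols.* An over-the-air optimization protocol $(\pi,\varphi)$ with at most $N$ channel uses consists of a code length $\ell$ and a number $T$ of queries with $\ell T\le N$, public randomness $U=(U_1,\dots,U_T)$ (of any joint law, independent of the oracle and of the channel), an encoder $\varphi$ which maps a gradient estimate and the public randomness to a codeword in $\mathbb R^\ell$ and satisfies the average power constraint $\mathbb E\|\varphi(\hat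 g,U_t)\|^2\le \ell P$ for every $t$ and every random vector $\hat g$ independent of $U$ with $\mathbb E\|\hat g\|^2\le B^2$, and an algorithm $\pi$. In iteration $t=1,\dots,T$, the algorithm chooses a query $x_t\in\mathcal X$ as a function of $U$ and $Y_1,\dots,Y_{t-1}$, the oracle supplies $\hat g_t=\hat g(x_t)$, and the algorithm receives $Y_t=\varphi(\hat g_t,U_t)+Z_t\in\mathbb R^\ell$, where all coordinates of all $Z_t$ are i.i.d. Gaussian with mean $0$ and variance $\sigma^2$. In the end the algorithm outputs a point $\hat x\in\mathcal X$ that is a function of $U$ and $Y_1,\dots,Y_T$. Its convergence error is $\mathcal E(f,\pi^{\varphi O})=\mathbb E f(\hat x)-\min_{x\in\mathcal X}f(x)$. *Min-max error.* Let $$\mathcal E^*(N)=\sup_{\mathcal X}\ \inf_{(\pi,\varphi)}\ \sup_{(f,O)\in\mathcal O}\mathcal E(f,\pi^{\varphi O}),$$ with $\mathcal X$ ranging over the sets above and $(\pi,\varphi)$ over the protocols on $\mathcal X$ with at most $N$ channel uses. **Theorem.** There is a universal constant $c\in(0,1)$ such that, for all $d\ge1$, $D,B,P,\sigma>0$ and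 all $N\ge \dfrac{d}{\log(1+\mathtt{SNR})}$, $$\mathcal E^*(N)\ \ge\ \frac{c\,D\,B}{\sqrt N}\cdot\sqrt{\frac{d}{\min\{d,\ \tfrac12\log(1+\mathtt{SNR})\}}}.$$ -/

import Mathlib

open MeasureTheory ProbabilityTheory
open scoped ENNReal

noncomputable section

namespace OverTheAir

/-- The domains of optimization: the nonempty closed convex sets of diameter at most `D` in `ℝ^d`. -/
structure IsFeasibleSet {d : ℕ} (D : ℝ) (X : Set (EuclideanSpace ℝ (Fin d))) : Prop where
  nonempty : X.Nonempty
  closed : IsClosed X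
  convex : Convex ℝ X
  diam_le : ∀ x ∈ X, ∀ y ∈ X, ‖x - y‖ ≤ D

/-- The set `∂f(x)` of subgradients at `x` of a function `f` on the domain `X`. -/
def subdifferential {d : ℕ} (X : Set (EuclideanSpace ℝ (Fin d)))
    (f : EuclideanSpace ℝ (Fin d) → ℝ) (x : EuclideanSpace ℝ (Fin d)) :
    Set (EuclideanSpace ℝ (Fin d)) :=
  {g | ∀ y ∈ X, f x + inner ℝ g (y - x) ≤ f y}

/-- A pair `(f, O)` of a convex function on `X` and a first order oracle for it. Only the values
of `f` on `X` matter. The oracle answers the query `x` by `grad (x, W)`, where the seed `W` of law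
`seedLaw` is drawn afresh at each query. -/
structure FunctionOracle {d : ℕ} (X : Set (EuclideanSpace ℝ (Fin d))) (B : ℝ) where
  f : EuclideanSpace ℝ (Fin d) → ℝ
  convexOn : ConvexOn ℝ X f
  Seed : Type
  [seedMeasurable : MeasurableSpace Seed]
  seedLaw : Measure Seed
  [seedProbability : IsProbabilityMeasure seedLaw]
  grad : X × Seed → EuclideanSpace ℝ (Fin d)
  measurable_grad : Measurable grad
  /-- unbiasedness (the integral exists by the next field) -/
  unbiased : ∀ x : X, (∫ w, grad (x, w) ∂seedLaw) ∈ subdifferential X f x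
  /-- mean square boundedness -/
  meanSquare : ∀ x : X, ∫⁻ w, ‖grad (x, w)‖ₑ ^ 2 ∂seedLaw ≤ ENNReal.ofReal (B ^ 2)

attribute [instance] FunctionOracle.seedMeasurable FunctionOracle.seedProbability

/-- The average power constraint for an encoder `φ` of length `ℓ` whose public randomness `U` has
law `μ`: `E ‖φ(g, U)‖² ≤ ℓ P` for every random vector `g`, independent of `U`, that an oracle with
mean square bound `B` may supply. -/
def PowerConstraint {d ℓ : ℕ} {R : Type} [MeasurableSpace R] (B P : ℝ)
    (φ : EuclideanSpace ℝ (Fin d) × R → EuclideanSpace ℝ (Fin ℓ)) (μ : Measure R) : Prop :=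
  ∀ ν : Measure (EuclideanSpace ℝ (Fin d)), IsProbabilityMeasure ν →
    ∫⁻ g, ‖g‖ₑ ^ 2 ∂ν ≤ ENNReal.ofReal (B ^ 2) →
      ∫⁻ g, ∫⁻ u, ‖φ (g, u)‖ₑ ^ 2 ∂μ ∂ν ≤ ENNReal.ofReal (ℓ * P)

/-- An over-the-air optimization protocol `(π, φ)` on the domain `X` with at most `N` channel uses:
a code of length `ℓ` with encoder `φ` and an algorithm that makes `T` queries, `ℓ * T ≤ N`.

The public randomness is a sequence `U = (U_1, …, U_T)` of arbitrary joint law; the `t`-th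
gradient estimate is encoded with `U_t`. A constant sequence is a single random draw used in all
iterations, an independent sequence is fresh randomness in each of them. The algorithm knows `U`;
its `t`-th query depends on `U` and on the channel outputs before time `t`, its final output on
`U` and on all `T` channel outputs. -/
structure Protocol {d : ℕ} (X : Set (EuclideanSpace ℝ (Fin d))) (B P : ℝ) (N : ℕ) where
  ℓ : ℕ
  T : ℕ
  channelUses : ℓ * T ≤ N
  R : Type
  [randMeasurable : MeasurableSpace R]
  randLaw : Measure (Fin T → R)
  [randProbability : IsProbabilityMeasure randLaw]
  encoder : EuclideanSpace ℝ (Fin d) × R → EuclideanSpace ℝ (Fin ℓ)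
  measurable_encoder : Measurable encoder
  power : ∀ t : Fin T, PowerConstraint B P encoder (randLaw.map fun u => u t)
  query : (t : Fin T) → (Fin T → R) × (Fin t → Fin ℓ → ℝ) → X
  measurable_query : ∀ t, Measurable (query t)
  output : (Fin T → R) × (Fin T → Fin ℓ → ℝ) → X
  measurable_output : Measurable output

attribute [instance] Protocol.randMeasurable Protocol.randProbability

variable {d : ℕ} {X : Set (EuclideanSpace ℝ (Fin d))} {B P : ℝ} {N : ℕ}

/-- The channel outputs of the first `t` iterations, given the public randomness `u`, the seeds
`w` of the oracle, and the channel noise `z`. -/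
def channelOutputs (p : Protocol X B P N) (O : FunctionOracle X B)
    (u : Fin p.T → p.R) (w : Fin p.T → O.Seed) (z : Fin p.T → Fin p.ℓ → ℝ) :
    (t : ℕ) → t ≤ p.T → (Fin t → Fin p.ℓ → ℝ)
  | 0, _ => Fin.elim0
  | t + 1, h =>
    let past := channelOutputs p O u w z t (Nat.le_of_succ_le h)
    let s : Fin p.T := ⟨t, h⟩
    let x := p.query s (u, past)
    let codeword := p.encoder (O.grad (x, w s), u s)
    Fin.snoc (α := fun _ => Fin p.ℓ → ℝ) past (fun i => codeword i + z s i)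

/-- The joint law of public randomness, oracle seeds and channel noise: the three are independent,
the seeds are i.i.d., and the noise is i.i.d. Gaussian with mean `0` and variance `σ²`. -/
def runLaw (p : Protocol X B P N) (O : FunctionOracle X B) (σ : ℝ) :
    Measure ((Fin p.T → p.R) × (Fin p.T → O.Seed) × (Fin p.T → Fin p.ℓ → ℝ)) :=
  p.randLaw.prod ((Measure.pi fun _ => O.seedLaw).prod
    (Measure.pi fun _ => Measure.pi fun _ => gaussianReal 0 (Real.toNNReal (σ ^ 2))))

/-- The point of `X` returned at the end of the run. -/
def finalPoint (p : Protocol X B P N) (O : FunctionOracle X B)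
    (ω : (Fin p.T → p.R) × (Fin p.T → O.Seed) × (Fin p.T → Fin p.ℓ → ℝ)) : X :=
  p.output (ω.1, channelOutputs p O ω.1 ω.2.1 ω.2.2 p.T le_rfl)

/-- The convergence error `E f(x_T) - min_X f`. On a domain `X`, the function `f` of a pair
`(f, O)` is Lipschitz and bounded, so that the expectation and the minimum exist. -/
def convergenceError (p : Protocol X B P N) (O : FunctionOracle X B) (σ : ℝ) : ℝ :=
  (∫ ω, O.f (finalPoint p O ω) ∂(runLaw p O σ)) - ⨅ x : X, O.f x

/-- `E*(N, X)`, the infimum over protocols of the worst-case convergence error. -/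
def minmaxErrorOn (X : Set (EuclideanSpace ℝ (Fin d))) (B P σ : ℝ) (N : ℕ) : EReal :=
  ⨅ p : Protocol X B P N, ⨆ O : FunctionOracle X B, (convergenceError p O σ : EReal)

/-- `E*(N)`, the supremum of `E*(N, X)` over the domains `X` of diameter at most `D` in `ℝ^d`. -/
def minmaxError (d : ℕ) (D B P σ : ℝ) (N : ℕ) : EReal :=
  ⨆ (X : Set (EuclideanSpace ℝ (Fin d))) (_ : IsFeasibleSet D X), minmaxErrorOn X B P σ N

end OverTheAir

end

/-
On a cube, let `f` be the linear function whose gradient is a small multiple `δ` of a sign vector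
`v`, and let the oracle answer every query by a random sign vector with mean `δ v`. The answers
ignore the query, so that, given the public randomness, the `T` channel outputs are independent
draws from a mixture of the output laws of the codewords. Flipping one sign of `v` multiplies the
weights of this mixture by a likelihood ratio that is affine in that sign, which bounds the squared
Hellinger distance of the outputs by `δ²` times the mean square of a posterior mean of the sign.
The sum of these mean squares over the signs is at most `d` by Jensen's inequality, and at most a
multiple of the capacity `ℓ log (1 + SNR)` because the signs are subgaussian: by the
Donsker-Varadhan inequality, the relative entropy to a Gaussian law bounds this sum. Squared Hellinger distances add up over the iterations, and Assouad's argument turns the bound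
for the sum over the signs into an error of order `D B δ` when `δ² N min (d, log (1 + SNR))` is a
small multiple of `d`.
-/

namespace OverTheAir

open scoped NNReal

section Density

/-- `f` is an everywhere positive probability density with respect to `μ`. -/
structure IsPosDensity {E : Type*} [MeasurableSpace E] (μ : Measure E) (f : E → ℝ) : Prop where
  measurable : Measurable f
  pos : ∀ y, 0 < f y
  integral_eq_one : ∫ y, f y ∂μ = 1

/-- The measure with density `f` with respect to `μ`, for a nonnegative real function `f`. -/
noncomputable def densityMeasure {E : Type*} [MeasurableSpace E] (μ : Measure E) (f : E → ℝ) :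
    Measure E :=
  μ.withDensity fun y => ENNReal.ofReal (f y)

/-- The integrand of the relative entropy of the density `f` with respect to the density `g`. -/
noncomputable def entropyIntegrand {E : Type*} (f g : E → ℝ) (y : E) : ℝ :=
  f y * (Real.log (f y) - Real.log (g y))

/-- The relative entropy (in nats) of the density `f` with respect to the density `g`. -/
noncomputable def relEntropy {E : Type*} [MeasurableSpace E] (μ : Measure E) (f g : E → ℝ) : ℝ :=
  ∫ y, entropyIntegrand f g y ∂μ

namespace IsPosDensity

variable {E : Type*} [MeasurableSpace E] {μ : Measure E} {f : E → ℝ}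

lemma integrable (hf : IsPosDensity μ f) : Integrable f μ :=
  .of_integral_ne_zero (hf.integral_eq_one ▸ one_ne_zero)

lemma lintegral_eq_one (hf : IsPosDensity μ f) : ∫⁻ y, ENNReal.ofReal (f y) ∂μ = 1 := by
  rw [← ofReal_integral_eq_lintegral_ofReal hf.integrable (.of_forall fun y => (hf.pos y).le),
    hf.integral_eq_one, ENNReal.ofReal_one]

lemma isProbabilityMeasure (hf : IsPosDensity μ f) :
    IsProbabilityMeasure (densityMeasure μ f) :=
  ⟨by rw [densityMeasure, withDensity_apply _ .univ, setLIntegral_univ, hf.lintegral_eq_one]⟩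

lemma integral_densityMeasure (hf : IsPosDensity μ f) (F : E → ℝ) :
    ∫ y, F y ∂densityMeasure μ f = ∫ y, f y * F y ∂μ := by
  rw [densityMeasure, integral_withDensity_eq_integral_toReal_smul
    hf.measurable.ennreal_ofReal (.of_forall fun _ => ENNReal.ofReal_lt_top)]
  simp only [ENNReal.toReal_ofReal (hf.pos _).le, smul_eq_mul]

lemma integrable_densityMeasure_iff (hf : IsPosDensity μ f) {F : E → ℝ} :
    Integrable F (densityMeasure μ f) ↔ Integrable (fun y => f y * F y) μ := by
  rw [densityMeasure, integrable_withDensity_iff_integrable_smul'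
    hf.measurable.ennreal_ofReal (.of_forall fun _ => ENNReal.ofReal_lt_top)]
  simp only [ENNReal.toReal_ofReal (hf.pos _).le, smul_eq_mul]

lemma prod_of_forall {α : Type*} [MeasurableSpace α] {ν : Measure α} [IsProbabilityMeasure ν]
    [SigmaFinite μ] {f : α × E → ℝ} (hm : Measurable f)
    (hf : ∀ u, IsPosDensity μ fun y => f (u, y)) : IsPosDensity (ν.prod μ) f := by
  have hpos : ∀ x, 0 < f x := fun x => (hf x.1).pos x.2
  refine ⟨hm, hpos, ?_⟩
  have hlint : ∫⁻ x, ENNReal.ofReal (f x) ∂ν.prod μ = 1 := by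
    rw [lintegral_prod _ hm.ennreal_ofReal.aemeasurable]
    simp only [(hf _).lintegral_eq_one, lintegral_const, measure_univ, mul_one]
  rw [integral_eq_lintegral_of_nonneg_ae (.of_forall fun x => (hpos x).le)
    hm.aestronglyMeasurable, hlint, ENNReal.toReal_one]

end IsPosDensity

section Pi

variable {κ : Type*} [Fintype κ] {E : κ → Type*} {f g : ∀ t, E t → ℝ}

lemma entropyIntegrand_pi (hf : ∀ t y, 0 < f t y) (hg : ∀ t y, 0 < g t y) (y : ∀ t, E t) :
    entropyIntegrand (fun y => ∏ t, f t (y t)) (fun y => ∏ t, g t (y t)) y =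
      (∏ t, f t (y t)) * ∑ t, (Real.log (f t (y t)) - Real.log (g t (y t))) := by
  rw [entropyIntegrand, Real.log_prod fun t _ => (hf t _).ne',
    Real.log_prod fun t _ => (hg t _).ne', Finset.sum_sub_distrib]

variable [∀ t, MeasurableSpace (E t)] {μ : ∀ t, Measure (E t)}

lemma integrable_logRatio_eval (hf : ∀ t, IsPosDensity (μ t) (f t))
    (hfg : ∀ t, Integrable (entropyIntegrand (f t) (g t)) (μ t)) (t : κ) :
    Integrable (fun y : ∀ t, E t => Real.log (f t (y t)) - Real.log (g t (y t)))
      (Measure.pi fun t => densityMeasure (μ t) (f t)) := by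
  have : ∀ t, IsProbabilityMeasure (densityMeasure (μ t) (f t)) :=
    fun t => (hf t).isProbabilityMeasure
  exact integrable_comp_eval (f := fun y => Real.log (f t y) - Real.log (g t y))
    ((hf t).integrable_densityMeasure_iff.2 (hfg t))

variable [∀ t, SigmaFinite (μ t)]

lemma IsPosDensity.pi (hf : ∀ t, IsPosDensity (μ t) (f t)) :
    IsPosDensity (Measure.pi μ) fun y => ∏ t, f t (y t) where
  measurable := Finset.measurable_prod _ fun t _ => (hf t).measurable.comp (measurable_pi_apply t)
  pos _ := Finset.prod_pos fun t _ => (hf t).pos _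
  integral_eq_one := by
    rw [integral_fintype_prod_eq_prod]
    exact Finset.prod_eq_one fun t _ => (hf t).integral_eq_one

lemma pi_densityMeasure (hf : ∀ t, IsPosDensity (μ t) (f t)) :
    Measure.pi (fun t => densityMeasure (μ t) (f t)) =
      densityMeasure (Measure.pi μ) fun y => ∏ t, f t (y t) := by
  have : ∀ t, IsProbabilityMeasure (densityMeasure (μ t) (f t)) :=
    fun t => (hf t).isProbabilityMeasure
  refine Measure.pi_eq fun s hs => ?_
  rw [densityMeasure, withDensity_apply _ (MeasurableSet.univ_pi hs), Measure.restrict_pi_pi,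
    ← ofReal_integral_eq_lintegral_ofReal
      (Integrable.fintype_prod_dep fun t => (hf t).integrable.restrict)
      (.of_forall fun y => Finset.prod_nonneg fun t _ => ((hf t).pos _).le),
    integral_fintype_prod_eq_prod,
    ENNReal.ofReal_prod_of_nonneg fun t _ => integral_nonneg fun y => ((hf t).pos y).le]
  refine Finset.prod_congr rfl fun t _ => ?_
  rw [densityMeasure, withDensity_apply _ (hs t), ofReal_integral_eq_lintegral_ofReal
    (hf t).integrable.restrict (.of_forall fun y => ((hf t).pos y).le)]

lemma integrable_entropyIntegrand_pi (hf : ∀ t, IsPosDensity (μ t) (f t))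
    (hg : ∀ t, IsPosDensity (μ t) (g t))
    (hfg : ∀ t, Integrable (entropyIntegrand (f t) (g t)) (μ t)) :
    Integrable (entropyIntegrand (fun y => ∏ t, f t (y t)) fun y => ∏ t, g t (y t))
      (Measure.pi μ) := by
  rw [funext (entropyIntegrand_pi (fun t => (hf t).pos) fun t => (hg t).pos),
    ← (IsPosDensity.pi hf).integrable_densityMeasure_iff, ← pi_densityMeasure hf]
  exact integrable_finsetSum _ fun t _ => integrable_logRatio_eval hf hfg t

lemma relEntropy_pi (hf : ∀ t, IsPosDensity (μ t) (f t)) (hg : ∀ t, IsPosDensity (μ t) (g t))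
    (hfg : ∀ t, Integrable (entropyIntegrand (f t) (g t)) (μ t)) :
    relEntropy (Measure.pi μ) (fun y => ∏ t, f t (y t)) (fun y => ∏ t, g t (y t)) =
      ∑ t, relEntropy (μ t) (f t) (g t) := by
  have : ∀ t, IsProbabilityMeasure (densityMeasure (μ t) (f t)) :=
    fun t => (hf t).isProbabilityMeasure
  rw [relEntropy, funext (entropyIntegrand_pi (fun t => (hf t).pos) fun t => (hg t).pos),
    ← (IsPosDensity.pi hf).integral_densityMeasure, ← pi_densityMeasure hf,
    integral_finsetSum _ fun t _ => integrable_logRatio_eval hf hfg t]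
  refine Finset.sum_congr rfl fun t _ => ?_
  rw [integral_comp_eval (f := fun y => Real.log (f t y) - Real.log (g t y))
    (((hf t).integrable_densityMeasure_iff.2 (hfg t)).aestronglyMeasurable),
    (hf t).integral_densityMeasure]
  rfl

end Pi

end Density

section Mixture

variable {S : Type*} [Fintype S]

/-- The density of the output of a channel with transition densities `k`, when the input has the
probability weights `p`. -/
def mixture {E : Type*} (p : S → ℝ) (k : S → E → ℝ) (y : E) : ℝ :=
  ∑ s, p s * k s y

/-- The conditional mean of `φ` at the channel input, given that the channel output is `y`. -/
noncomputable def posteriorMean {E : Type*} (p : S → ℝ) (k : S → E → ℝ) (φ : S → ℝ) (y : E) : ℝ :=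
  (∑ s, p s * k s y * φ s) / mixture p k y

/-- The second moment of the conditional mean of `φ` given the channel output. -/
noncomputable def posteriorMeanSq {E : Type*} [MeasurableSpace E] (μ : Measure E) (p : S → ℝ)
    (k : S → E → ℝ) (φ : S → ℝ) : ℝ :=
  ∫ y, mixture p k y * posteriorMean p k φ y ^ 2 ∂μ

/-- The family `φ` of statistics is jointly subgaussian with variance proxy `K` under the
weights `p`. -/
def IsSubgaussianFamily {κ : Type*} [Fintype κ] (p : S → ℝ) (φ : κ → S → ℝ) (K : ℝ) : Prop :=
  ∀ θ : κ → ℝ, ∑ s, p s * Real.exp (∑ j, θ j * φ j s) ≤ Real.exp (K / 2 * ∑ j, θ j ^ 2)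

variable {E : Type*} [MeasurableSpace E] {μ : Measure E} {p : S → ℝ} {k : S → E → ℝ}

lemma IsPosDensity.mixture (hp : p ∈ stdSimplex ℝ S) (hk : ∀ s, IsPosDensity μ (k s)) :
    IsPosDensity μ (mixture p k) where
  measurable := Finset.measurable_sum _ fun s _ => (hk s).measurable.const_mul (p s)
  pos y := by
    obtain ⟨s, -, hs⟩ : ∃ s ∈ Finset.univ, 0 < p s :=
      Finset.exists_lt_of_sum_lt (f := fun _ => (0 : ℝ)) (by simp [hp.2])
    exact Finset.sum_pos' (fun s _ => mul_nonneg (hp.1 s) ((hk s).pos y).le)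
      ⟨s, Finset.mem_univ s, mul_pos hs ((hk s).pos y)⟩
  integral_eq_one := by
    unfold OverTheAir.mixture
    rw [integral_finsetSum _ fun s _ => (hk s).integrable.const_mul (p s)]
    simp only [integral_const_mul, (hk _).integral_eq_one, mul_one, hp.2]

lemma mixture_mul_posteriorMean (hp : p ∈ stdSimplex ℝ S) (hk : ∀ s, IsPosDensity μ (k s))
    (φ : S → ℝ) (y : E) :
    mixture p k y * posteriorMean p k φ y = ∑ s, p s * k s y * φ s :=
  mul_div_cancel₀ _ ((IsPosDensity.mixture hp hk).pos y).ne'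

lemma mixture_mul_posteriorMean_sq_le (hp : p ∈ stdSimplex ℝ S) (hk : ∀ s, IsPosDensity μ (k s))
    (φ : S → ℝ) (y : E) :
    mixture p k y * posteriorMean p k φ y ^ 2 ≤ ∑ s, p s * k s y * φ s ^ 2 := by
  have hq := (IsPosDensity.mixture hp hk).pos y
  have hw : ∀ s, 0 ≤ p s * k s y := fun s => mul_nonneg (hp.1 s) ((hk s).pos y).le
  have hcs : (∑ s, p s * k s y * φ s) ^ 2 ≤ mixture p k y * ∑ s, p s * k s y * φ s ^ 2 :=
    Finset.sum_sq_le_sum_mul_sum_of_sq_le_mul _ (fun s _ => hw s)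
      (fun s _ => mul_nonneg (hw s) (sq_nonneg _)) fun s _ => le_of_eq (by ring)
  rw [← mixture_mul_posteriorMean hp hk, mul_pow, sq (mixture p k y), mul_assoc] at hcs
  exact le_of_mul_le_mul_left hcs hq

lemma integrable_mixture_mul_posteriorMean_sq (hp : p ∈ stdSimplex ℝ S)
    (hk : ∀ s, IsPosDensity μ (k s)) (φ : S → ℝ) :
    Integrable (fun y => mixture p k y * posteriorMean p k φ y ^ 2) μ := by
  have hq := IsPosDensity.mixture hp hk
  have hm : Measurable (posteriorMean p k φ) := (Finset.measurable_sum _ fun s _ =>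
    ((hk s).measurable.const_mul (p s)).mul_const (φ s)).div hq.measurable
  refine (integrable_finsetSum Finset.univ fun s _ =>
    ((hk s).integrable.const_mul (p s)).mul_const (φ s ^ 2)).mono'
    (hq.measurable.mul (hm.pow_const 2)).aestronglyMeasurable (.of_forall fun y => ?_)
  rw [Real.norm_of_nonneg (mul_nonneg (hq.pos y).le (sq_nonneg _))]
  exact mixture_mul_posteriorMean_sq_le hp hk φ y

lemma posteriorMeanSq_le_sum (hp : p ∈ stdSimplex ℝ S) (hk : ∀ s, IsPosDensity μ (k s))
    (φ : S → ℝ) : posteriorMeanSq μ p k φ ≤ ∑ s, p s * φ s ^ 2 := by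
  have hint : ∀ s, Integrable (fun y => p s * k s y * φ s ^ 2) μ := fun s =>
    ((hk s).integrable.const_mul (p s)).mul_const _
  calc posteriorMeanSq μ p k φ
      ≤ ∫ y, ∑ s, p s * k s y * φ s ^ 2 ∂μ :=
        integral_mono (integrable_mixture_mul_posteriorMean_sq hp hk φ)
          (integrable_finsetSum _ fun s _ => hint s) (mixture_mul_posteriorMean_sq_le hp hk φ)
    _ = ∑ s, p s * φ s ^ 2 := by
        rw [integral_finsetSum _ fun s _ => hint s]
        simp only [integral_mul_const, integral_const_mul, (hk _).integral_eq_one, mul_one]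

lemma mul_add_one_sub_mul_exp_le {x r : ℝ} (hx : 0 < x) (hr : 0 < r) (h : ℝ) :
    x * (h + 1) - r * Real.exp h ≤ x * (Real.log x - Real.log r) := by
  have hexp : x * Real.exp (h - (Real.log x - Real.log r)) = r * Real.exp h := by
    rw [Real.exp_sub, Real.exp_sub, Real.exp_log hx, Real.exp_log hr]
    field_simp
  have hmul := mul_le_mul_of_nonneg_left
    (Real.add_one_le_exp (h - (Real.log x - Real.log r))) hx.le
  linarith

lemma sum_mul_add_sub_le_of_sum_mul_exp_le_one {x h : S → ℝ} {r : ℝ} (hp : ∀ s, 0 ≤ p s)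
    (hx : ∀ s, 0 < x s) (hr : 0 < r) (hexp : ∑ s, p s * Real.exp (h s) ≤ 1) :
    ∑ s, p s * x s * h s + (∑ s, p s * x s - r) ≤
      ∑ s, p s * (x s * (Real.log (x s) - Real.log r)) :=
  calc ∑ s, p s * x s * h s + (∑ s, p s * x s - r)
      ≤ ∑ s, p s * x s * h s + (∑ s, p s * x s - r * ∑ s, p s * Real.exp (h s)) := by
        gcongr
        exact mul_le_of_le_one_right hr.le hexp
    _ = ∑ s, p s * (x s * (h s + 1) - r * Real.exp (h s)) := by
        rw [Finset.mul_sum, ← Finset.sum_sub_distrib, ← Finset.sum_add_distrib]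
        exact Finset.sum_congr rfl fun s _ => by ring
    _ ≤ ∑ s, p s * (x s * (Real.log (x s) - Real.log r)) :=
        Finset.sum_le_sum fun s _ =>
          mul_le_mul_of_nonneg_left (mul_add_one_sub_mul_exp_le (hx s) hr (h s)) (hp s)

variable {κ : Type*} [Fintype κ] {φ : κ → S → ℝ} {K : ℝ}

lemma IsSubgaussianFamily.sum_mul_exp_sub_le_one (hφ : IsSubgaussianFamily p φ K) (θ : κ → ℝ) :
    ∑ s, p s * Real.exp (∑ j, θ j * φ j s - K / 2 * ∑ j, θ j ^ 2) ≤ 1 := by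
  simp only [Real.exp_sub, ← mul_div_assoc]
  rw [← Finset.sum_div]
  exact div_le_one_of_le₀ (hφ θ) (Real.exp_pos _).le

/- The tilt `h s = ∑ j, m j / K * φ j s - ∑ j, m j ^ 2 / (2 * K)`, with `m j` the posterior mean of
`φ j`, is the optimal one in the Donsker-Varadhan inequality under the subgaussian bound. -/
lemma mixture_mul_sum_posteriorMean_sq_le (hp : p ∈ stdSimplex ℝ S)
    (hk : ∀ s, IsPosDensity μ (k s)) {r : E → ℝ} (hr : ∀ y, 0 < r y) (hK : 0 < K)
    (hφ : IsSubgaussianFamily p φ K) (y : E) :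
    (∑ j, mixture p k y * posteriorMean p k (φ j) y ^ 2) / (2 * K) + (mixture p k y - r y) ≤
      ∑ s, p s * entropyIntegrand (k s) r y := by
  set m : κ → ℝ := fun j => posteriorMean p k (φ j) y
  set θ : κ → ℝ := fun j => m j / K
  have hlin : ∑ s, p s * k s y * ∑ j, θ j * φ j s =
      (∑ j, mixture p k y * m j ^ 2) / K := by
    calc ∑ s, p s * k s y * ∑ j, θ j * φ j s
        = ∑ j, θ j * ∑ s, p s * k s y * φ j s := by
          simp only [Finset.mul_sum]
          rw [Finset.sum_comm]
          exact Finset.sum_congr rfl fun j _ => Finset.sum_congr rfl fun s _ => by ring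
      _ = ∑ j, mixture p k y * m j ^ 2 / K := Finset.sum_congr rfl fun j _ => by
          rw [← mixture_mul_posteriorMean hp hk]
          ring
      _ = (∑ j, mixture p k y * m j ^ 2) / K := (Finset.sum_div _ _ _).symm
  have hquad : mixture p k y * (K / 2 * ∑ j, θ j ^ 2) =
      (∑ j, mixture p k y * m j ^ 2) / (2 * K) := by
    simp only [θ, div_pow, ← Finset.sum_div, ← Finset.mul_sum]
    field_simp
  have htilt : ∑ s, p s * k s y * (∑ j, θ j * φ j s - K / 2 * ∑ j, θ j ^ 2) =
      (∑ j, mixture p k y * m j ^ 2) / (2 * K) := by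
    simp only [mul_sub, Finset.sum_sub_distrib]
    rw [hlin, ← Finset.sum_mul, ← mixture.eq_def p k y, hquad]
    field_simp
    ring
  rw [← htilt]
  exact sum_mul_add_sub_le_of_sum_mul_exp_le_one hp.1 (fun s => (hk s).pos y) (hr y)
    (hφ.sum_mul_exp_sub_le_one θ)

theorem sum_posteriorMeanSq_le_relEntropy (hp : p ∈ stdSimplex ℝ S)
    (hk : ∀ s, IsPosDensity μ (k s)) {r : E → ℝ} (hr : IsPosDensity μ r)
    (hkr : ∀ s, Integrable (entropyIntegrand (k s) r) μ) (hK : 0 < K)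
    (hφ : IsSubgaussianFamily p φ K) :
    ∑ j, posteriorMeanSq μ p k (φ j) ≤ 2 * K * ∑ s, p s * relEntropy μ (k s) r := by
  have hq := IsPosDensity.mixture hp hk
  have hm : ∀ j, Integrable (fun y => mixture p k y * posteriorMean p k (φ j) y ^ 2) μ :=
    fun j => integrable_mixture_mul_posteriorMean_sq hp hk (φ j)
  have hL := (integrable_finsetSum Finset.univ fun j _ => hm j).div_const (2 * K)
  have hR : ∀ s, Integrable (fun y => p s * entropyIntegrand (k s) r y) μ :=
    fun s => (hkr s).const_mul (p s)
  have hI := integral_mono (hL.add (hq.integrable.sub hr.integrable))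
    (integrable_finsetSum Finset.univ fun s _ => hR s)
    (mixture_mul_sum_posteriorMean_sq_le hp hk hr.pos hK hφ)
  rw [integral_add' hL (hq.integrable.sub hr.integrable), integral_div,
    integral_finsetSum _ fun j _ => hm j, integral_sub' hq.integrable hr.integrable,
    hq.integral_eq_one, hr.integral_eq_one, sub_self, add_zero,
    integral_finsetSum _ fun s _ => hR s, div_le_iff₀' (by positivity)] at hI
  simpa only [integral_const_mul, posteriorMeanSq, relEntropy] using hI

end Mixture

section Hellinger

/-- The squared Hellinger distance of two densities, normalized to have the maximum `2`. -/
noncomputable def hellingerSq {E : Type*} [MeasurableSpace E] (μ : Measure E) (f g : E → ℝ) : ℝ :=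
  ∫ y, (√(f y) - √(g y)) ^ 2 ∂μ

lemma sq_sqrt_sub_sqrt {x y : ℝ} (hx : 0 ≤ x) (hy : 0 ≤ y) :
    (√x - √y) ^ 2 = x + y - 2 * (√x * √y) := by
  rw [sub_sq, Real.sq_sqrt hx, Real.sq_sqrt hy]
  ring

lemma sq_sqrt_sub_sqrt_le {x y : ℝ} (hx : 0 < x) (hy : 0 ≤ y) :
    (√x - √y) ^ 2 ≤ (y - x) ^ 2 / x := by
  have hfac : y - x = (√y - √x) * (√y + √x) := by
    linear_combination Real.sq_sqrt hx.le - Real.sq_sqrt hy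
  have hsum : x ≤ (√y + √x) ^ 2 :=
    calc x = √x ^ 2 := (Real.sq_sqrt hx.le).symm
      _ ≤ (√y + √x) ^ 2 := by
        gcongr
        exact le_add_of_nonneg_left (Real.sqrt_nonneg y)
  rw [le_div_iff₀ hx, hfac, mul_pow, sub_sq_comm]
  exact mul_le_mul_of_nonneg_left hsum (sq_nonneg _)

lemma abs_sub_le_sq_sqrt_sub_sqrt_add {x y : ℝ} (hx : 0 ≤ x) (hy : 0 ≤ y) :
    |x - y| ≤ (√x - √y) ^ 2 + (x + y) / 2 := by
  obtain ⟨hx', hy'⟩ := And.intro (Real.sq_sqrt hx) (Real.sq_sqrt hy)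
  rw [abs_le]
  constructor <;>
    nlinarith [Real.sqrt_nonneg x, Real.sqrt_nonneg y, sq_nonneg (3 * √x - √y),
      sq_nonneg (√x - 3 * √y)]

lemma one_sub_prod_le_sum {κ : Type*} (s : Finset κ) {ρ : κ → ℝ} (h0 : ∀ t, 0 ≤ ρ t)
    (h1 : ∀ t, ρ t ≤ 1) : 1 - ∏ t ∈ s, ρ t ≤ ∑ t ∈ s, (1 - ρ t) := by
  classical
  induction s using Finset.induction_on with
  | empty => simp
  | insert t s ht ih =>
    rw [Finset.prod_insert ht, Finset.sum_insert ht]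
    have hs : ∏ i ∈ s, ρ i ≤ 1 := Finset.prod_le_one (fun i _ => h0 i) fun i _ => h1 i
    linarith [mul_nonneg (sub_nonneg.2 (h1 t)) (sub_nonneg.2 hs)]

variable {E : Type*} [MeasurableSpace E] {μ : Measure E} {f g : E → ℝ}

lemma IsPosDensity.integrable_sqrt_mul_sqrt (hf : IsPosDensity μ f) (hg : IsPosDensity μ g) :
    Integrable (fun y => √(f y) * √(g y)) μ := by
  refine (hf.integrable.add hg.integrable).mono'
    (hf.measurable.sqrt.mul hg.measurable.sqrt).aestronglyMeasurable (.of_forall fun y => ?_)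
  have hsq := sq_sqrt_sub_sqrt (hf.pos y).le (hg.pos y).le
  have hnn : 0 ≤ √(f y) * √(g y) := by positivity
  rw [Real.norm_of_nonneg hnn, Pi.add_apply]
  linarith [sq_nonneg (√(f y) - √(g y))]

lemma IsPosDensity.integrable_sq_sqrt_sub_sqrt (hf : IsPosDensity μ f) (hg : IsPosDensity μ g) :
    Integrable (fun y => (√(f y) - √(g y)) ^ 2) μ := by
  simp only [sq_sqrt_sub_sqrt (hf.pos _).le (hg.pos _).le]
  exact (hf.integrable.add hg.integrable).sub ((hf.integrable_sqrt_mul_sqrt hg).const_mul 2)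

lemma hellingerSq_eq (hf : IsPosDensity μ f) (hg : IsPosDensity μ g) :
    hellingerSq μ f g = 2 * (1 - ∫ y, √(f y) * √(g y) ∂μ) := by
  simp only [hellingerSq, sq_sqrt_sub_sqrt (hf.pos _).le (hg.pos _).le]
  have hadd : Integrable (fun y => f y + g y) μ := hf.integrable.add hg.integrable
  rw [integral_sub hadd ((hf.integrable_sqrt_mul_sqrt hg).const_mul 2),
    integral_add hf.integrable hg.integrable, hf.integral_eq_one, hg.integral_eq_one,
    integral_const_mul]
  ring

lemma hellingerSq_nonneg (μ : Measure E) (f g : E → ℝ) : 0 ≤ hellingerSq μ f g :=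
  integral_nonneg fun _ => sq_nonneg _

lemma integral_abs_sub_le_one_add_hellingerSq (hf : IsPosDensity μ f) (hg : IsPosDensity μ g) :
    ∫ y, |f y - g y| ∂μ ≤ 1 + hellingerSq μ f g := by
  have hH := hf.integrable_sq_sqrt_sub_sqrt hg
  have hadd : Integrable (fun y => (f y + g y) / 2) μ :=
    (hf.integrable.add hg.integrable).div_const 2
  calc ∫ y, |f y - g y| ∂μ
      ≤ ∫ y, ((√(f y) - √(g y)) ^ 2 + (f y + g y) / 2) ∂μ :=
        integral_mono (hf.integrable.sub hg.integrable).abs (hH.add hadd)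
          fun y => abs_sub_le_sq_sqrt_sub_sqrt_add (hf.pos y).le (hg.pos y).le
    _ = 1 + hellingerSq μ f g := by
        rw [integral_add hH hadd, integral_div, integral_add hf.integrable hg.integrable,
          hf.integral_eq_one, hg.integral_eq_one, hellingerSq]
        ring

lemma hellingerSq_pi_le {κ : Type*} [Fintype κ] {E : κ → Type*} [∀ t, MeasurableSpace (E t)]
    {μ : ∀ t, Measure (E t)} [∀ t, SigmaFinite (μ t)] {f g : ∀ t, E t → ℝ}
    (hf : ∀ t, IsPosDensity (μ t) (f t)) (hg : ∀ t, IsPosDensity (μ t) (g t)) :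
    hellingerSq (Measure.pi μ) (fun y => ∏ t, f t (y t)) (fun y => ∏ t, g t (y t)) ≤
      ∑ t, hellingerSq (μ t) (f t) (g t) := by
  set ρ : κ → ℝ := fun t => ∫ y, √(f t y) * √(g t y) ∂μ t
  have hρ0 : ∀ t, 0 ≤ ρ t := fun t => integral_nonneg fun y => by positivity
  have hρ1 : ∀ t, ρ t ≤ 1 := fun t => by
    linarith [hellingerSq_eq (hf t) (hg t), hellingerSq_nonneg (μ t) (f t) (g t)]
  have hprod : ∫ y, √(∏ t, f t (y t)) * √(∏ t, g t (y t)) ∂Measure.pi μ = ∏ t, ρ t := by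
    simp only [Real.sqrt_prod _ fun t _ => ((hf t).pos _).le,
      Real.sqrt_prod _ fun t _ => ((hg t).pos _).le, ← Finset.prod_mul_distrib]
    exact integral_fintype_prod_eq_prod (fun t y => √(f t y) * √(g t y))
  rw [hellingerSq_eq (.pi hf) (.pi hg), hprod]
  simp only [fun t => hellingerSq_eq (hf t) (hg t), ← Finset.mul_sum]
  gcongr
  exact one_sub_prod_le_sum _ hρ0 hρ1

lemma hellingerSq_prod {α : Type*} [MeasurableSpace α] {ν : Measure α} [SFinite ν] [SFinite μ]
    {f g : α × E → ℝ} (hf : IsPosDensity (ν.prod μ) f) (hg : IsPosDensity (ν.prod μ) g) :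
    hellingerSq (ν.prod μ) f g =
      ∫ u, hellingerSq μ (fun y => f (u, y)) (fun y => g (u, y)) ∂ν :=
  integral_prod _ (hf.integrable_sq_sqrt_sub_sqrt hg)

lemma hellingerSq_mixture_le {S : Type*} [Fintype S] {p p' φ : S → ℝ} {k : S → E → ℝ}
    (hp : p ∈ stdSimplex ℝ S) (hp' : p' ∈ stdSimplex ℝ S) (hpp' : ∀ s, p' s = p s * (1 + φ s))
    (hk : ∀ s, IsPosDensity μ (k s)) :
    hellingerSq μ (mixture p k) (mixture p' k) ≤ posteriorMeanSq μ p k φ := by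
  have hq := IsPosDensity.mixture hp hk
  have hq' := IsPosDensity.mixture hp' hk
  refine integral_mono (hq.integrable_sq_sqrt_sub_sqrt hq')
    (integrable_mixture_mul_posteriorMean_sq hp hk φ) fun y => ?_
  have hchange : mixture p' k y - mixture p k y = mixture p k y * posteriorMean p k φ y := by
    rw [mixture_mul_posteriorMean hp hk, mixture, mixture, ← Finset.sum_sub_distrib]
    exact Finset.sum_congr rfl fun s _ => by rw [hpp']; ring
  refine (sq_sqrt_sub_sqrt_le (hq.pos y) (hq'.pos y).le).trans_eq ?_
  have hne := (hq.pos y).ne'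
  rw [hchange]
  field_simp

end Hellinger

section Assouad

/-- The sign `±1` of a Boolean. -/
def boolSign (b : Bool) : ℝ := if b then 1 else -1

lemma boolSign_not (b : Bool) : boolSign (!b) = -boolSign b := by cases b <;> simp [boolSign]

lemma abs_boolSign (b : Bool) : |boolSign b| = 1 := by cases b <;> simp [boolSign]

variable {ι : Type*} [DecidableEq ι]

/-- The vertex of the hypercube that differs from `v` in the coordinate `i` only. -/
def flipAt (i : ι) (v : ι → Bool) : ι → Bool := Function.update v i (!v i)

lemma flipAt_involutive (i : ι) : Function.Involutive (flipAt i) := fun v => by simp [flipAt]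

variable [Fintype ι]

lemma exists_sum_boolSign_mul_le {e : (ι → Bool) → ι → ℝ} {M : ℝ}
    (h : ∀ v, ∑ i, boolSign (v i) * (e v i - e (flipAt i v) i) ≤ 2 * M) :
    ∃ v, ∑ i, boolSign (v i) * e v i ≤ M := by
  have hflip : ∀ i, ∑ v, boolSign (v i) * e (flipAt i v) i = -∑ v, boolSign (v i) * e v i := by
    intro i
    rw [← (flipAt_involutive i).bijective.sum_comp fun v => boolSign (v i) * e v i,
      ← Finset.sum_neg_distrib]
    refine Finset.sum_congr rfl fun v _ => ?_
    rw [flipAt, Function.update_self, boolSign_not, neg_mul, neg_neg]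
  have hsum : ∑ v, ∑ i, boolSign (v i) * (e v i - e (flipAt i v) i) =
      ∑ v, 2 * ∑ i, boolSign (v i) * e v i := by
    simp only [Finset.mul_sum]
    rw [Finset.sum_comm, Finset.sum_comm (γ := ι → Bool)]
    refine Finset.sum_congr rfl fun i _ => ?_
    simp only [mul_sub, Finset.sum_sub_distrib, hflip, ← Finset.mul_sum]
    ring
  obtain ⟨v, -, hv⟩ := Finset.exists_le_of_sum_le Finset.univ_nonempty
    (hsum ▸ Finset.sum_le_sum fun v _ => h v)
  exact ⟨v, le_of_mul_le_mul_left hv two_pos⟩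

variable {Ω : Type*} [MeasurableSpace Ω] {μ : Measure Ω}

lemma integral_mul_sub_integral_mul_le {f g G : Ω → ℝ} (hf : IsPosDensity μ f)
    (hg : IsPosDensity μ g) (hG : Measurable G) {r : ℝ} (hr : 0 ≤ r) (hGr : ∀ x, |G x| ≤ r) :
    |∫ x, f x * G x ∂μ - ∫ x, g x * G x ∂μ| ≤ r * (1 + hellingerSq μ f g) := by
  have hmul : ∀ {q}, IsPosDensity μ q → Integrable (fun x => q x * G x) μ := fun hq =>
    hq.integrable.mul_bdd hG.aestronglyMeasurable (.of_forall hGr)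
  have hfg := (hf.integrable.sub hg.integrable).abs
  calc |∫ x, f x * G x ∂μ - ∫ x, g x * G x ∂μ|
      = |∫ x, (f x * G x - g x * G x) ∂μ| := by rw [integral_sub (hmul hf) (hmul hg)]
    _ ≤ ∫ x, |f x * G x - g x * G x| ∂μ := abs_integral_le_integral_abs
    _ ≤ ∫ x, r * |f x - g x| ∂μ := by
        refine integral_mono ((hmul hf).sub (hmul hg)).abs (hfg.const_mul r) fun x => ?_
        simp only [← sub_mul, abs_mul, mul_comm r]
        exact mul_le_mul_of_nonneg_left (hGr x) (abs_nonneg _)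
    _ = r * ∫ x, |f x - g x| ∂μ := integral_const_mul _ _
    _ ≤ r * (1 + hellingerSq μ f g) := by
        gcongr
        exact integral_abs_sub_le_one_add_hellingerSq hf hg

theorem exists_sum_boolSign_mul_integral_le {f : (ι → Bool) → Ω → ℝ}
    (hf : ∀ v, IsPosDensity μ (f v)) {G : ι → Ω → ℝ} (hG : ∀ i, Measurable (G i)) {r H : ℝ}
    (hr : 0 ≤ r) (hGr : ∀ i x, |G i x| ≤ r)
    (hH : ∀ v, ∑ i, hellingerSq μ (f v) (f (flipAt i v)) ≤ H) :
    ∃ v, ∑ i, boolSign (v i) * ∫ x, f v x * G i x ∂μ ≤ r * (Fintype.card ι + H) / 2 := by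
  refine exists_sum_boolSign_mul_le fun v => ?_
  calc ∑ i, boolSign (v i) * (∫ x, f v x * G i x ∂μ - ∫ x, f (flipAt i v) x * G i x ∂μ)
      ≤ ∑ i, r * (1 + hellingerSq μ (f v) (f (flipAt i v))) :=
        Finset.sum_le_sum fun i _ => (le_abs_self _).trans <| by
          rw [abs_mul, abs_boolSign, one_mul]
          exact integral_mul_sub_integral_mul_le (hf v) (hf _) (hG i) hr (hGr i)
    _ = r * (Fintype.card ι + ∑ i, hellingerSq μ (f v) (f (flipAt i v))) := by
        rw [← Finset.mul_sum, Finset.sum_add_distrib, Finset.sum_const, nsmul_eq_mul, mul_one,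
          Finset.card_univ]
    _ ≤ r * (Fintype.card ι + H) := by gcongr; exact hH v
    _ = 2 * (r * (Fintype.card ι + H) / 2) := by ring

end Assouad

section ProductWeight

variable {A : Type*} [Fintype A]

lemma exp_mul_le_cosh_add_sinh {x M : ℝ} (hM : 0 < M) (hx : |x| ≤ M) (θ : ℝ) :
    Real.exp (θ * x) ≤ Real.cosh (θ * M) + x / M * Real.sinh (θ * M) := by
  obtain ⟨hxl, hxu⟩ := abs_le.1 hx
  have hconv := convexOn_exp.2 (Set.mem_univ (θ * M)) (Set.mem_univ (-(θ * M)))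
    (div_nonneg (neg_le_iff_add_nonneg.1 hxl) (by positivity : 0 ≤ 2 * M))
    (div_nonneg (sub_nonneg.2 hxu) (by positivity : 0 ≤ 2 * M)) (by field_simp; ring)
  simp only [smul_eq_mul] at hconv
  calc Real.exp (θ * x)
      = Real.exp ((x + M) / (2 * M) * (θ * M) + (M - x) / (2 * M) * -(θ * M)) := by
        congr 1
        field_simp
        ring
    _ ≤ (x + M) / (2 * M) * Real.exp (θ * M) + (M - x) / (2 * M) * Real.exp (-(θ * M)) := hconv
    _ = Real.cosh (θ * M) + x / M * Real.sinh (θ * M) := by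
        rw [Real.cosh_eq, Real.sinh_eq]
        field_simp
        ring

lemma sum_mul_exp_mul_le {q φ : A → ℝ} {M : ℝ} (hq : q ∈ stdSimplex ℝ A) (hM : 0 < M)
    (hφM : ∀ a, |φ a| ≤ M) (hφ : ∑ a, q a * φ a = 0) (θ : ℝ) :
    ∑ a, q a * Real.exp (θ * φ a) ≤ Real.exp (M ^ 2 / 2 * θ ^ 2) :=
  calc ∑ a, q a * Real.exp (θ * φ a)
      ≤ ∑ a, q a * (Real.cosh (θ * M) + φ a / M * Real.sinh (θ * M)) :=
        Finset.sum_le_sum fun a _ => mul_le_mul_of_nonneg_left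
          (exp_mul_le_cosh_add_sinh hM (hφM a) θ) (hq.1 a)
    _ = (∑ a, q a) * Real.cosh (θ * M) + (∑ a, q a * φ a) * (Real.sinh (θ * M) / M) := by
        rw [Finset.sum_mul, Finset.sum_mul, ← Finset.sum_add_distrib]
        exact Finset.sum_congr rfl fun a _ => by ring
    _ = Real.cosh (θ * M) := by rw [hq.2, hφ, one_mul, zero_mul, add_zero]
    _ ≤ Real.exp ((θ * M) ^ 2 / 2) := Real.cosh_le_exp_half_sq _
    _ = Real.exp (M ^ 2 / 2 * θ ^ 2) := by ring_nf

variable {ι : Type*} [Fintype ι]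

/-- The weights of a vector of independent coordinates with the weights `q i`. -/
def productWeight {A : Type*} (q : ι → A → ℝ) (s : ι → A) : ℝ := ∏ i, q i (s i)

lemma productWeight_update [DecidableEq ι] {A : Type*} {q : ι → A → ℝ} {i : ι} {q' φ : A → ℝ}
    (h : ∀ a, q' a = q i a * (1 + φ a)) (s : ι → A) :
    productWeight (Function.update q i q') s = productWeight q s * (1 + φ (s i)) := by
  have herase : ∏ j ∈ Finset.univ.erase i, Function.update q i q' j (s j) =
      ∏ j ∈ Finset.univ.erase i, q j (s j) :=
    Finset.prod_congr rfl fun j hj => by rw [Function.update_of_ne (Finset.ne_of_mem_erase hj)]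
  rw [productWeight, productWeight, ← Finset.mul_prod_erase _ _ (Finset.mem_univ i),
    ← Finset.mul_prod_erase _ (fun j => q j (s j)) (Finset.mem_univ i), herase,
    Function.update_self, h]
  ring

variable [DecidableEq ι] {q : ι → A → ℝ}

lemma productWeight_mem_stdSimplex (hq : ∀ i, q i ∈ stdSimplex ℝ A) :
    productWeight q ∈ stdSimplex ℝ (ι → A) := by
  refine ⟨fun s => Finset.prod_nonneg fun i _ => (hq i).1 _, ?_⟩
  unfold productWeight
  rw [← Fintype.prod_sum]
  exact Finset.prod_eq_one fun i _ => (hq i).2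

lemma sum_productWeight_mul_prod (q g : ι → A → ℝ) :
    ∑ s, productWeight q s * ∏ i, g i (s i) = ∏ i, ∑ a, q i a * g i a := by
  simp only [productWeight, ← Finset.prod_mul_distrib]
  exact (Fintype.prod_sum fun i a => q i a * g i a).symm

lemma sum_productWeight_mul (hq : ∀ i, q i ∈ stdSimplex ℝ A) (i : ι) (g : A → ℝ) :
    ∑ s, productWeight q s * g (s i) = ∑ a, q i a * g a := by
  have h := sum_productWeight_mul_prod q fun j => if j = i then g else fun _ => 1
  rw [Finset.prod_eq_single i (fun j _ hj => by simp [hj, (hq j).2]) (by simp)] at h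
  simpa [ite_apply, Finset.prod_ite_eq'] using h

lemma isSubgaussianFamily_productWeight (hq : ∀ i, q i ∈ stdSimplex ℝ A) {φ : ι → A → ℝ} {K : ℝ}
    (hφ : ∀ i θ, ∑ a, q i a * Real.exp (θ * φ i a) ≤ Real.exp (K / 2 * θ ^ 2)) :
    IsSubgaussianFamily (productWeight q) (fun i s => φ i (s i)) K := fun θ =>
  calc ∑ s, productWeight q s * Real.exp (∑ i, θ i * φ i (s i))
      = ∏ i, ∑ a, q i a * Real.exp (θ i * φ i a) := by
        simp only [Real.exp_sum]
        exact sum_productWeight_mul_prod q fun i a => Real.exp (θ i * φ i a)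
    _ ≤ ∏ i, Real.exp (K / 2 * θ i ^ 2) :=
        Finset.prod_le_prod (fun i _ => Finset.sum_nonneg fun a _ =>
          mul_nonneg ((hq i).1 a) (Real.exp_pos _).le) fun i _ => hφ i (θ i)
    _ = Real.exp (K / 2 * ∑ i, θ i ^ 2) := by rw [← Real.exp_sum, Finset.mul_sum]

variable {E : Type*} [MeasurableSpace E] {μ : Measure E} {k : (ι → A) → E → ℝ}
  {q' φ : ι → A → ℝ} {M : ℝ}

lemma sum_hellingerSq_update_le (hq : ∀ i, q i ∈ stdSimplex ℝ A)
    (hq' : ∀ i, q' i ∈ stdSimplex ℝ A) (hφ : ∀ i a, q' i a = q i a * (1 + φ i a))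
    (hk : ∀ s, IsPosDensity μ (k s)) :
    ∑ i, hellingerSq μ (mixture (productWeight q) k)
        (mixture (productWeight (Function.update q i (q' i))) k) ≤
      ∑ i, posteriorMeanSq μ (productWeight q) k fun s => φ i (s i) := by
  refine Finset.sum_le_sum fun i _ => hellingerSq_mixture_le (productWeight_mem_stdSimplex hq)
    (productWeight_mem_stdSimplex fun j => ?_) (productWeight_update (hφ i)) hk
  rcases eq_or_ne j i with rfl | hj
  · rw [Function.update_self]
    exact hq' j
  · rw [Function.update_of_ne hj]
    exact hq j

theorem sum_hellingerSq_update_le_card (hq : ∀ i, q i ∈ stdSimplex ℝ A)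
    (hq' : ∀ i, q' i ∈ stdSimplex ℝ A) (hφ : ∀ i a, q' i a = q i a * (1 + φ i a))
    (hφM : ∀ i a, |φ i a| ≤ M) (hk : ∀ s, IsPosDensity μ (k s)) :
    ∑ i, hellingerSq μ (mixture (productWeight q) k)
        (mixture (productWeight (Function.update q i (q' i))) k) ≤ M ^ 2 * Fintype.card ι := by
  have hp := productWeight_mem_stdSimplex hq
  calc _ ≤ ∑ i, posteriorMeanSq μ (productWeight q) k fun s => φ i (s i) :=
        sum_hellingerSq_update_le hq hq' hφ hk
    _ ≤ ∑ _i : ι, M ^ 2 := Finset.sum_le_sum fun i _ =>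
        calc _ ≤ ∑ s, productWeight q s * φ i (s i) ^ 2 := posteriorMeanSq_le_sum hp hk _
          _ ≤ ∑ s, productWeight q s * M ^ 2 := Finset.sum_le_sum fun s _ =>
              mul_le_mul_of_nonneg_left (sq_le_sq.2 ((hφM i _).trans (le_abs_self M))) (hp.1 s)
          _ = M ^ 2 := by rw [← Finset.sum_mul, hp.2, one_mul]
    _ = M ^ 2 * Fintype.card ι := by
        rw [Finset.sum_const, nsmul_eq_mul, Finset.card_univ, mul_comm]

theorem sum_hellingerSq_update_le_relEntropy (hq : ∀ i, q i ∈ stdSimplex ℝ A)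
    (hq' : ∀ i, q' i ∈ stdSimplex ℝ A) (hφ : ∀ i a, q' i a = q i a * (1 + φ i a)) (hM : 0 < M)
    (hφM : ∀ i a, |φ i a| ≤ M) (hk : ∀ s, IsPosDensity μ (k s)) {r : E → ℝ}
    (hr : IsPosDensity μ r) (hkr : ∀ s, Integrable (entropyIntegrand (k s) r) μ) :
    ∑ i, hellingerSq μ (mixture (productWeight q) k)
        (mixture (productWeight (Function.update q i (q' i))) k) ≤
      2 * M ^ 2 * ∑ s, productWeight q s * relEntropy μ (k s) r := by
  have hcentered : ∀ i, ∑ a, q i a * φ i a = 0 := fun i => by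
    have h := (hq' i).2
    simp only [hφ, mul_add, mul_one, Finset.sum_add_distrib, (hq i).2] at h
    linarith
  exact (sum_hellingerSq_update_le hq hq' hφ hk).trans <|
    sum_posteriorMeanSq_le_relEntropy (productWeight_mem_stdSimplex hq) hk hr hkr (by positivity) <|
      isSubgaussianFamily_productWeight hq fun i θ =>
        sum_mul_exp_mul_le (hq i) hM (hφM i) (hcentered i) θ

end ProductWeight

section Hypercube

/-- The probability of the sign `c` under the distribution on signs with mean `δ * boolSign b`. -/
noncomputable def signWeight (δ : ℝ) (b c : Bool) : ℝ := (1 + δ * (boolSign b * boolSign c)) / 2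

/-- The relative change of the probability of the sign `c` when the bias `b` is flipped. -/
noncomputable def flipScore (δ : ℝ) (b c : Bool) : ℝ :=
  signWeight δ (!b) c / signWeight δ b c - 1

/-- The distribution on sign vectors with independent coordinates and mean `δ` times the sign
vector `v`. -/
noncomputable def cubeWeight {ι : Type*} [Fintype ι] (δ : ℝ) (v : ι → Bool) : (ι → Bool) → ℝ :=
  productWeight fun i => signWeight δ (v i)

lemma boolSign_mul_eq (b c : Bool) :
    boolSign b * boolSign c = 1 ∨ boolSign b * boolSign c = -1 := by
  cases b <;> cases c <;> simp [boolSign]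

lemma sum_signWeight_mul_boolSign (δ : ℝ) (b : Bool) :
    ∑ c, signWeight δ b c * boolSign c = δ * boolSign b := by
  cases b <;> simp [signWeight, boolSign] <;> ring

variable {δ : ℝ}

lemma signWeight_pos (h0 : 0 ≤ δ) (h1 : δ ≤ 1 / 2) (b c : Bool) : 0 < signWeight δ b c := by
  unfold signWeight
  rcases boolSign_mul_eq b c with h | h <;> rw [h] <;> linarith

lemma signWeight_mem_stdSimplex (h0 : 0 ≤ δ) (h1 : δ ≤ 1 / 2) (b : Bool) :
    signWeight δ b ∈ stdSimplex ℝ Bool :=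
  ⟨fun c => (signWeight_pos h0 h1 b c).le, by cases b <;> simp [signWeight, boolSign] <;> ring⟩

lemma signWeight_mul_one_add_flipScore (h0 : 0 ≤ δ) (h1 : δ ≤ 1 / 2) (b c : Bool) :
    signWeight δ b c * (1 + flipScore δ b c) = signWeight δ (!b) c := by
  rw [flipScore, add_sub_cancel, mul_div_cancel₀ _ (signWeight_pos h0 h1 b c).ne']

lemma abs_flipScore_le (h0 : 0 ≤ δ) (h1 : δ ≤ 1 / 2) (b c : Bool) : |flipScore δ b c| ≤ 4 * δ := by
  have hpos := signWeight_pos h0 h1 b c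
  have hquarter : 1 / 4 ≤ signWeight δ b c := by
    unfold signWeight
    rcases boolSign_mul_eq b c with h | h <;> rw [h] <;> linarith
  have hdiff : |signWeight δ (!b) c - signWeight δ b c| = δ := by
    have : signWeight δ (!b) c - signWeight δ b c = -(δ * (boolSign b * boolSign c)) := by
      rw [signWeight, signWeight, boolSign_not]
      ring
    rw [this, abs_neg, abs_mul, abs_mul, abs_boolSign, abs_boolSign, abs_of_nonneg h0, one_mul,
      mul_one]
  rw [flipScore, div_sub_one hpos.ne', abs_div, hdiff, abs_of_pos hpos, div_le_iff₀ hpos]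
  nlinarith

variable {ι : Type*} [Fintype ι] [DecidableEq ι]

lemma cubeWeight_mem_stdSimplex (h0 : 0 ≤ δ) (h1 : δ ≤ 1 / 2) (v : ι → Bool) :
    cubeWeight δ v ∈ stdSimplex ℝ (ι → Bool) :=
  productWeight_mem_stdSimplex fun i => signWeight_mem_stdSimplex h0 h1 (v i)

lemma sum_cubeWeight_mul_boolSign (h0 : 0 ≤ δ) (h1 : δ ≤ 1 / 2) (v : ι → Bool) (i : ι) :
    ∑ s, cubeWeight δ v s * boolSign (s i) = δ * boolSign (v i) :=
  (sum_productWeight_mul (fun i => signWeight_mem_stdSimplex h0 h1 (v i)) i boolSign).trans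
    (sum_signWeight_mul_boolSign δ (v i))

lemma cubeWeight_flipAt (δ : ℝ) (v : ι → Bool) (i : ι) :
    cubeWeight δ (flipAt i v) =
      productWeight (Function.update (fun j => signWeight δ (v j)) i (signWeight δ (!v i))) := by
  rw [cubeWeight, flipAt]
  congr 1
  exact funext fun j => Function.apply_update (fun _ => signWeight δ) v i (!v i) j

variable {E : Type*} [MeasurableSpace E] {μ : Measure E} {k : (ι → Bool) → E → ℝ}

lemma sum_hellingerSq_flipAt_le_card (h0 : 0 ≤ δ) (h1 : δ ≤ 1 / 2) (v : ι → Bool)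
    (hk : ∀ s, IsPosDensity μ (k s)) :
    ∑ i, hellingerSq μ (mixture (cubeWeight δ v) k) (mixture (cubeWeight δ (flipAt i v)) k) ≤
      16 * δ ^ 2 * Fintype.card ι := by
  simp only [cubeWeight_flipAt]
  refine (sum_hellingerSq_update_le_card (fun i => signWeight_mem_stdSimplex h0 h1 (v i))
    (fun i => signWeight_mem_stdSimplex h0 h1 (!v i))
    (fun i a => (signWeight_mul_one_add_flipScore h0 h1 (v i) a).symm)
    (fun i a => abs_flipScore_le h0 h1 (v i) a) hk).trans_eq (by ring)

lemma sum_hellingerSq_flipAt_le_relEntropy (h0 : 0 < δ) (h1 : δ ≤ 1 / 2) (v : ι → Bool)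
    (hk : ∀ s, IsPosDensity μ (k s)) {r : E → ℝ} (hr : IsPosDensity μ r)
    (hkr : ∀ s, Integrable (entropyIntegrand (k s) r) μ) :
    ∑ i, hellingerSq μ (mixture (cubeWeight δ v) k) (mixture (cubeWeight δ (flipAt i v)) k) ≤
      32 * δ ^ 2 * ∑ s, cubeWeight δ v s * relEntropy μ (k s) r := by
  simp only [cubeWeight_flipAt]
  refine (sum_hellingerSq_update_le_relEntropy
    (fun i => signWeight_mem_stdSimplex h0.le h1 (v i))
    (fun i => signWeight_mem_stdSimplex h0.le h1 (!v i))
    (fun i a => (signWeight_mul_one_add_flipScore h0.le h1 (v i) a).symm) (by positivity)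
    (fun i a => abs_flipScore_le h0.le h1 (v i) a) hk hr hkr).trans_eq ?_
  rw [cubeWeight]
  ring

end Hypercube

section Gaussian

variable {v w : ℝ≥0}

lemma isPosDensity_gaussianPDFReal (hv : v ≠ 0) (m : ℝ) :
    IsPosDensity volume (gaussianPDFReal m v) where
  measurable := measurable_gaussianPDFReal m v
  pos y := gaussianPDFReal_pos m v y hv
  integral_eq_one := integral_gaussianPDFReal_eq_one m hv

lemma gaussianReal_eq_densityMeasure (hv : v ≠ 0) (m : ℝ) :
    gaussianReal m v = densityMeasure volume (gaussianPDFReal m v) :=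
  gaussianReal_of_var_ne_zero m hv

lemma log_gaussianPDFReal_sub_log (hv : v ≠ 0) (hw : w ≠ 0) (m b x : ℝ) :
    Real.log (gaussianPDFReal m v x) - Real.log (gaussianPDFReal b w x) =
      1 / 2 * Real.log (w / v) + ((x - b) ^ 2 / (2 * w) - (x - m) ^ 2 / (2 * v)) := by
  have hlog : ∀ {v : ℝ≥0}, v ≠ 0 → ∀ m, Real.log (gaussianPDFReal m v x) =
      -(1 / 2 * (Real.log (2 * Real.pi) + Real.log v)) - (x - m) ^ 2 / (2 * v) := by
    intro v hv m
    have hv0 : (0 : ℝ) < v := NNReal.coe_pos.2 (pos_iff_ne_zero.2 hv)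
    rw [gaussianPDFReal, Real.log_mul (by positivity) (Real.exp_pos _).ne', Real.log_exp,
      Real.log_inv, Real.log_sqrt (by positivity), Real.log_mul (by positivity) hv0.ne']
    ring
  rw [hlog hv, hlog hw, Real.log_div (NNReal.coe_ne_zero.2 hw) (NNReal.coe_ne_zero.2 hv)]
  ring

lemma integrable_sq_sub_gaussianReal (v : ℝ≥0) (m b : ℝ) :
    Integrable (fun x => (x - b) ^ 2) (gaussianReal m v) :=
  ((memLp_id_gaussianReal 2).sub (memLp_const b)).integrable_sq

lemma integral_sq_sub_gaussianReal (v : ℝ≥0) (m b : ℝ) :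
    ∫ x, (x - b) ^ 2 ∂gaussianReal m v = v + (m - b) ^ 2 := by
  have hvar := variance_eq_sub (memLp_id_gaussianReal (μ := m - b) (v := v) 2)
  simp only [variance_id_gaussianReal, Pi.pow_apply, id, integral_id_gaussianReal] at hvar
  rw [← integral_map (f := fun x => x ^ 2) (measurable_sub_const b).aemeasurable (by fun_prop),
    gaussianReal_map_sub_const, hvar, sub_add_cancel]

lemma integrable_entropyIntegrand_gaussianPDFReal (hv : v ≠ 0) (hw : w ≠ 0) (m b : ℝ) :
    Integrable (entropyIntegrand (gaussianPDFReal m v) (gaussianPDFReal b w)) volume := by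
  refine (isPosDensity_gaussianPDFReal hv m).integrable_densityMeasure_iff.1 ?_
  simp only [← gaussianReal_eq_densityMeasure hv, log_gaussianPDFReal_sub_log hv hw]
  exact (integrable_const _).add (((integrable_sq_sub_gaussianReal v m b).div_const _).sub
    ((integrable_sq_sub_gaussianReal v m m).div_const _))

lemma relEntropy_gaussianPDFReal (hv : v ≠ 0) (hw : w ≠ 0) (m b : ℝ) :
    relEntropy volume (gaussianPDFReal m v) (gaussianPDFReal b w) =
      1 / 2 * Real.log (w / v) + ((m - b) ^ 2 - (w - v)) / (2 * w) := by
  have hb := (integrable_sq_sub_gaussianReal v m b).div_const (2 * w)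
  have hm := (integrable_sq_sub_gaussianReal v m m).div_const (2 * v)
  have hv0 : (v : ℝ) ≠ 0 := NNReal.coe_ne_zero.2 hv
  have hw0 : (w : ℝ) ≠ 0 := NNReal.coe_ne_zero.2 hw
  unfold relEntropy entropyIntegrand
  rw [← (isPosDensity_gaussianPDFReal hv m).integral_densityMeasure,
    ← gaussianReal_eq_densityMeasure hv]
  simp only [log_gaussianPDFReal_sub_log hv hw]
  have hsub : Integrable (fun x => (x - b) ^ 2 / (2 * w) - (x - m) ^ 2 / (2 * v))
      (gaussianReal m v) := hb.sub hm
  rw [integral_add (integrable_const _) hsub, integral_sub hb hm, integral_div, integral_div,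
    integral_sq_sub_gaussianReal, integral_sq_sub_gaussianReal, integral_const, probReal_univ,
    one_smul]
  field_simp
  ring

variable {ι : Type*} [Fintype ι]

/-- The density of the Gaussian vector with mean `m` and independent coordinates of variance
`v`. -/
noncomputable def gaussDensity (v : ℝ≥0) (m y : ι → ℝ) : ℝ := ∏ i, gaussianPDFReal (m i) v (y i)

lemma isPosDensity_gaussDensity (hv : v ≠ 0) (m : ι → ℝ) :
    IsPosDensity volume (gaussDensity v m) :=
  .pi fun i => isPosDensity_gaussianPDFReal hv (m i)

lemma measurable_uncurry_gaussDensity (v : ℝ≥0) :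
    Measurable fun x : (ι → ℝ) × (ι → ℝ) => gaussDensity v x.1 x.2 := by
  refine Finset.measurable_prod _ fun i _ => measurable_uncurry_gaussianPDFReal.comp
    (f := fun x : (ι → ℝ) × (ι → ℝ) => (x.1 i, v, x.2 i)) ?_
  fun_prop

lemma pi_gaussianReal_map_add (v : ℝ≥0) (m : ι → ℝ) :
    (Measure.pi fun _ => gaussianReal 0 v).map (fun z i => m i + z i) =
      Measure.pi fun i => gaussianReal (m i) v := by
  rw [Measure.pi_map_pi fun i => (measurable_const_add (m i)).aemeasurable]
  simp only [gaussianReal_map_const_add, zero_add]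

lemma pi_gaussianReal_eq_densityMeasure (hv : v ≠ 0) (m : ι → ℝ) :
    Measure.pi (fun i => gaussianReal (m i) v) = densityMeasure volume (gaussDensity v m) := by
  simp only [gaussianReal_eq_densityMeasure hv]
  exact pi_densityMeasure fun i => isPosDensity_gaussianPDFReal hv (m i)

lemma integrable_entropyIntegrand_gaussDensity (hv : v ≠ 0) (hw : w ≠ 0) (m b : ι → ℝ) :
    Integrable (entropyIntegrand (gaussDensity v m) (gaussDensity w b)) volume :=
  integrable_entropyIntegrand_pi (fun i => isPosDensity_gaussianPDFReal hv (m i))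
    (fun i => isPosDensity_gaussianPDFReal hw (b i))
    fun i => integrable_entropyIntegrand_gaussianPDFReal hv hw (m i) (b i)

lemma relEntropy_gaussDensity (hv : v ≠ 0) (hw : w ≠ 0) (m b : ι → ℝ) :
    relEntropy volume (gaussDensity v m) (gaussDensity w b) =
      Fintype.card ι / 2 * Real.log (w / v) +
        (∑ i, (m i - b i) ^ 2 - Fintype.card ι * (w - v)) / (2 * w) := by
  refine (relEntropy_pi (fun i => isPosDensity_gaussianPDFReal hv (m i))
    (fun i => isPosDensity_gaussianPDFReal hw (b i))
    fun i => integrable_entropyIntegrand_gaussianPDFReal hv hw (m i) (b i)).trans ?_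
  simp only [relEntropy_gaussianPDFReal hv hw, Finset.sum_add_distrib, ← Finset.sum_div,
    Finset.sum_sub_distrib, Finset.sum_const, Finset.card_univ, nsmul_eq_mul]
  ring

end Gaussian

section Transcript

variable {κ S R E : Type*} [Fintype κ] [Fintype S]

/-- The joint density of the public randomness and of the channel outputs, when the channel inputs
are independent symbols with the weights `p`, and `k s r` is the output density for the symbol `s`
under the public randomness `r`. -/
def transcriptDensity (p : S → ℝ) (k : S → R → E → ℝ) (x : (κ → R) × (κ → E)) : ℝ :=
  ∏ t, mixture p (fun s => k s (x.1 t)) (x.2 t)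

variable [MeasurableSpace R] [MeasurableSpace E] {μ : Measure (κ → R)} {vol : Measure E}
  {p : S → ℝ} {k : S → R → E → ℝ}

lemma measurable_transcriptDensity (p : S → ℝ)
    (hkm : ∀ s, Measurable fun x : R × E => k s x.1 x.2) :
    Measurable (transcriptDensity (κ := κ) p k) :=
  Finset.measurable_prod _ fun t _ => Finset.measurable_sum _ fun s _ =>
    ((hkm s).comp (f := fun x : (κ → R) × (κ → E) => (x.1 t, x.2 t)) (by fun_prop)).const_mul (p s)

lemma isPosDensity_transcriptDensity [SigmaFinite vol] [IsProbabilityMeasure μ]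
    (hp : p ∈ stdSimplex ℝ S)
    (hk : ∀ s r, IsPosDensity vol (k s r)) (hkm : ∀ s, Measurable fun x : R × E => k s x.1 x.2) :
    IsPosDensity (μ.prod (Measure.pi fun _ => vol)) (transcriptDensity p k) :=
  .prod_of_forall (measurable_transcriptDensity p hkm) fun u =>
    .pi fun t => .mixture hp fun s => hk s (u t)

section Law

variable [MeasurableSpace S] [MeasurableSingletonClass S] {Z : Type*} [MeasurableSpace Z]
  {ν : Measure S} [IsProbabilityMeasure ν] {γ : Measure Z} [SigmaFinite γ]

lemma measureReal_singleton_mem_stdSimplex (ν : Measure S) [IsProbabilityMeasure ν] :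
    (fun s => ν.real {s}) ∈ stdSimplex ℝ S :=
  ⟨fun _ => measureReal_nonneg, by
    rw [sum_measureReal_singleton, Finset.coe_univ, probReal_univ]⟩

lemma map_prod_eq_densityMeasure_mixture {h : S × Z → E} {k : S → E → ℝ} (hh : Measurable h)
    (hk : ∀ s, IsPosDensity vol (k s))
    (hlaw : ∀ s, γ.map (fun z => h (s, z)) = densityMeasure vol (k s)) :
    (ν.prod γ).map h = densityMeasure vol (mixture (fun s => ν.real {s}) k) := by
  have hterm : ∀ s, Measurable fun y => ν.real {s} * k s y :=
    fun s => (hk s).measurable.const_mul _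
  refine Measure.ext_of_lintegral _ fun F hF => ?_
  calc ∫⁻ y, F y ∂(ν.prod γ).map h
      = ∑ s, (∫⁻ z, F (h (s, z)) ∂γ) * ν {s} := by
        rw [lintegral_map hF hh, lintegral_prod (fun x => F (h x)) (hF.comp hh).aemeasurable,
          lintegral_fintype]
    _ = ∑ s, ∫⁻ y, ENNReal.ofReal (ν.real {s} * k s y) * F y ∂vol := by
        refine Finset.sum_congr rfl fun s _ => ?_
        have hks : Measurable fun y => ENNReal.ofReal (k s y) := (hk s).measurable.ennreal_ofReal
        have hhs : Measurable fun z => h (s, z) := hh.comp measurable_prodMk_left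
        rw [← lintegral_map hF hhs, hlaw, densityMeasure,
          lintegral_withDensity_eq_lintegral_mul _ hks hF, mul_comm,
          ← lintegral_const_mul _ (hks.mul hF)]
        simp only [ENNReal.ofReal_mul measureReal_nonneg,
          ofReal_measureReal (measure_ne_top ν {s}), mul_assoc, Pi.mul_apply]
    _ = ∫⁻ y, ∑ s, ENNReal.ofReal (ν.real {s} * k s y) * F y ∂vol :=
        (lintegral_finsetSum _ fun s _ => (hterm s).ennreal_ofReal.mul hF).symm
    _ = ∫⁻ y, F y ∂densityMeasure vol (mixture (fun s => ν.real {s}) k) := by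
        have hmix : Measurable fun y => ENNReal.ofReal (mixture (fun s => ν.real {s}) k y) :=
          (Finset.measurable_sum _ fun s _ => hterm s).ennreal_ofReal
        rw [densityMeasure, lintegral_withDensity_eq_lintegral_mul _ hmix hF]
        simp only [← Finset.sum_mul, Pi.mul_apply, mixture, ENNReal.ofReal_sum_of_nonneg
          fun s _ => mul_nonneg measureReal_nonneg ((hk s).pos _).le]

lemma map_prod_pi_eq_densityMeasure [SigmaFinite vol] {h : κ → S × Z → E}
    {k : κ → S → E → ℝ} (hh : ∀ t, Measurable (h t)) (hk : ∀ t s, IsPosDensity vol (k t s))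
    (hlaw : ∀ t s, γ.map (fun z => h t (s, z)) = densityMeasure vol (k t s)) :
    ((Measure.pi fun _ => ν).prod (Measure.pi fun _ => γ)).map (fun x t => h t (x.1 t, x.2 t)) =
      densityMeasure (Measure.pi fun _ => vol)
        fun y => ∏ t, mixture (fun s => ν.real {s}) (k t) (y t) := by
  have hmix : ∀ t, IsPosDensity vol (mixture (fun s => ν.real {s}) (k t)) := fun t =>
    .mixture (measureReal_singleton_mem_stdSimplex ν) (hk t)
  have hmap : ∀ t, (ν.prod γ).map (h t) =
      densityMeasure vol (mixture (fun s => ν.real {s}) (k t)) := fun t =>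
    map_prod_eq_densityMeasure_mixture (hh t) (hk t) (hlaw t)
  have : ∀ t, SigmaFinite ((ν.prod γ).map (h t)) := fun t => by
    have := (hmix t).isProbabilityMeasure
    rw [hmap]
    infer_instance
  have hpair := measurePreserving_arrowProdEquivProdArrow S Z κ (fun _ => ν) (fun _ => γ)
  have hh' : Measurable fun (x : (κ → S) × (κ → Z)) t => h t (x.1 t, x.2 t) :=
    measurable_pi_lambda _ fun t => (hh t).comp (by fun_prop)
  rw [← hpair.map_eq, Measure.map_map hh' hpair.measurable, ← pi_densityMeasure hmix]
  simp only [← hmap]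
  exact Measure.pi_map_pi fun t => (hh t).aemeasurable

lemma map_runs_eq_densityMeasure [SigmaFinite vol] [SFinite μ] {h : S × R × Z → E}
    (hh : Measurable h)
    (hk : ∀ s r, IsPosDensity vol (k s r)) (hkm : ∀ s, Measurable fun x : R × E => k s x.1 x.2)
    (hlaw : ∀ s r, γ.map (fun z => h (s, r, z)) = densityMeasure vol (k s r)) :
    (μ.prod ((Measure.pi fun _ => ν).prod (Measure.pi fun _ => γ))).map
        (fun ω => (ω.1, fun t => h (ω.2.1 t, ω.1 t, ω.2.2 t))) =
      densityMeasure (μ.prod (Measure.pi fun _ => vol))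
        (transcriptDensity (fun s => ν.real {s}) k) := by
  refine Measure.ext_of_lintegral _ fun F hF => ?_
  have hH : Measurable fun ω : (κ → R) × (κ → S) × (κ → Z) =>
      (ω.1, fun t => h (ω.2.1 t, ω.1 t, ω.2.2 t)) := by fun_prop
  have htd : Measurable fun x : (κ → R) × (κ → E) =>
      ENNReal.ofReal (transcriptDensity (fun s => ν.real {s}) k x) :=
    (measurable_transcriptDensity _ hkm).ennreal_ofReal
  have hF' : Measurable fun ω : (κ → R) × (κ → S) × (κ → Z) =>
      F (ω.1, fun t => h (ω.2.1 t, ω.1 t, ω.2.2 t)) := hF.comp hH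
  rw [lintegral_map hF hH, lintegral_prod _ hF'.aemeasurable, densityMeasure,
    lintegral_withDensity_eq_lintegral_mul _ htd hF, lintegral_prod _ (htd.mul hF).aemeasurable]
  refine lintegral_congr fun u => ?_
  have hFu : Measurable fun y => F (u, y) := hF.comp measurable_prodMk_left
  have hHu : Measurable fun (x : (κ → S) × (κ → Z)) t => h (x.1 t, u t, x.2 t) := by fun_prop
  have htdu : Measurable fun y =>
      ENNReal.ofReal (transcriptDensity (fun s => ν.real {s}) k (u, y)) :=
    htd.comp measurable_prodMk_left
  have hfibre : ((Measure.pi fun _ => ν).prod (Measure.pi fun _ => γ)).map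
      (fun x t => h (x.1 t, u t, x.2 t)) = densityMeasure (Measure.pi fun _ => vol)
        fun y => transcriptDensity (fun s => ν.real {s}) k (u, y) :=
    map_prod_pi_eq_densityMeasure (h := fun t x => h (x.1, u t, x.2))
      (k := fun t s => k s (u t)) (fun t => by fun_prop) (fun t s => hk s (u t))
      fun t s => hlaw s (u t)
  rw [← lintegral_map hFu hHu, hfibre, densityMeasure,
    lintegral_withDensity_eq_lintegral_mul _ htdu hFu]
  simp only [Pi.mul_apply]

end Law

lemma sum_hellingerSq_transcriptDensity_le [SigmaFinite vol] [IsProbabilityMeasure μ]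
    {ι : Type*} [Fintype ι]
    {p' : ι → S → ℝ} {b : R → ℝ} (hp : p ∈ stdSimplex ℝ S) (hp' : ∀ i, p' i ∈ stdSimplex ℝ S)
    (hk : ∀ s r, IsPosDensity vol (k s r)) (hkm : ∀ s, Measurable fun x : R × E => k s x.1 x.2)
    (hb : ∀ r, ∑ i, hellingerSq vol (mixture p fun s => k s r) (mixture (p' i) fun s => k s r) ≤
      b r) (hbi : ∀ t, Integrable (fun u => b (u t)) μ) :
    ∑ i, hellingerSq (μ.prod (Measure.pi fun _ => vol)) (transcriptDensity p k)
      (transcriptDensity (p' i) k) ≤ ∑ t, ∫ u, b (u t) ∂μ := by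
  have htd := isPosDensity_transcriptDensity (μ := μ) hp hk hkm
  have htd' := fun i => isPosDensity_transcriptDensity (μ := μ) (hp' i) hk hkm
  have hint : ∀ i, Integrable (fun u => hellingerSq (Measure.pi fun _ => vol)
      (fun y => transcriptDensity p k (u, y)) fun y => transcriptDensity (p' i) k (u, y)) μ :=
    fun i => (htd.integrable_sq_sqrt_sub_sqrt (htd' i)).integral_prod_left
  simp only [fun i => hellingerSq_prod htd (htd' i)]
  rw [← integral_finsetSum _ fun i _ => hint i, ← integral_finsetSum _ fun t _ => hbi t]
  refine integral_mono (integrable_finsetSum _ fun i _ => hint i)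
    (integrable_finsetSum _ fun t _ => hbi t) fun u => ?_
  calc ∑ i, hellingerSq (Measure.pi fun _ => vol) (fun y => transcriptDensity p k (u, y))
        (fun y => transcriptDensity (p' i) k (u, y))
      ≤ ∑ i, ∑ t, hellingerSq vol (mixture p fun s => k s (u t))
          (mixture (p' i) fun s => k s (u t)) :=
        Finset.sum_le_sum fun i _ => hellingerSq_pi_le (fun t => .mixture hp fun s => hk s (u t))
          fun t => .mixture (hp' i) fun s => hk s (u t)
    _ ≤ ∑ t, b (u t) := by
        rw [Finset.sum_comm]
        exact Finset.sum_le_sum fun t _ => hb (u t)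

end Transcript

section Run

variable {d N : ℕ} {X : Set (EuclideanSpace ℝ (Fin d))} {B P : ℝ}

lemma channelOutputs_of_grad_eq (p : Protocol X B P N) (O : FunctionOracle X B)
    {g : O.Seed → EuclideanSpace ℝ (Fin d)} (hg : ∀ x w, O.grad (x, w) = g w)
    (u : Fin p.T → p.R) (w : Fin p.T → O.Seed) (z : Fin p.T → Fin p.ℓ → ℝ) (t : ℕ)
    (h : t ≤ p.T) :
    channelOutputs p O u w z t h = fun j i =>
      p.encoder (g (w (Fin.castLE h j)), u (Fin.castLE h j)) i + z (Fin.castLE h j) i := by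
  induction t with
  | zero => ext j; exact j.elim0
  | succ t ih =>
    ext j i
    simp only [channelOutputs, hg, ih]
    refine Fin.lastCases ?_ (fun k => ?_) j
    · simp only [Fin.snoc_last]; rfl
    · simp only [Fin.snoc_castSucc]; rfl

namespace Protocol

/-- The density of the channel output in one iteration of the protocol, for noise of variance `τ`
and a gradient estimate `c s` encoded with the public randomness `ρ`. -/
noncomputable def outputKernel {S : Type*} (p : Protocol X B P N) (τ : ℝ≥0)
    (c : S → EuclideanSpace ℝ (Fin d)) (s : S) (ρ : p.R) : (Fin p.ℓ → ℝ) → ℝ :=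
  gaussDensity τ fun i => p.encoder (c s, ρ) i

variable {S : Type*} {c : S → EuclideanSpace ℝ (Fin d)} {τ : ℝ≥0}

lemma isPosDensity_outputKernel (p : Protocol X B P N) (hτ : τ ≠ 0) (s : S) (ρ : p.R) :
    IsPosDensity volume (p.outputKernel τ c s ρ) :=
  isPosDensity_gaussDensity hτ _

lemma measurable_outputKernel (p : Protocol X B P N) (s : S) :
    Measurable fun x : p.R × (Fin p.ℓ → ℝ) => p.outputKernel τ c s x.1 x.2 := by
  have he := p.measurable_encoder
  exact (measurable_uncurry_gaussDensity τ).comp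
    (f := fun x : p.R × (Fin p.ℓ → ℝ) => ((fun i => p.encoder (c s, x.1) i : Fin p.ℓ → ℝ), x.2))
    (by fun_prop)

lemma map_runLaw_eq_densityMeasure (p : Protocol X B P N) (O : FunctionOracle X B)
    [Fintype O.Seed] [MeasurableSingletonClass O.Seed] {g : O.Seed → EuclideanSpace ℝ (Fin d)}
    (hg : ∀ x w, O.grad (x, w) = g w) {σ : ℝ} (hσ : 0 < σ) :
    (runLaw p O σ).map (fun ω => (ω.1, channelOutputs p O ω.1 ω.2.1 ω.2.2 p.T le_rfl)) =
      densityMeasure (p.randLaw.prod (Measure.pi fun _ => volume))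
        (transcriptDensity (fun w => O.seedLaw.real {w})
          (p.outputKernel (σ ^ 2).toNNReal g)) := by
  have hτ : (σ ^ 2).toNNReal ≠ 0 := (Real.toNNReal_pos.2 (by positivity)).ne'
  have he := p.measurable_encoder
  have hgm : Measurable g := measurable_of_finite g
  have hh : Measurable fun x : O.Seed × p.R × (Fin p.ℓ → ℝ) =>
      fun i => p.encoder (g x.1, x.2.1) i + x.2.2 i := by fun_prop
  simp only [channelOutputs_of_grad_eq p O hg, Fin.castLE_rfl, id_eq]
  refine map_runs_eq_densityMeasure hh (p.isPosDensity_outputKernel hτ)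
    p.measurable_outputKernel fun w ρ => ?_
  exact (pi_gaussianReal_map_add _ fun i => p.encoder (g w, ρ) i).trans
    (pi_gaussianReal_eq_densityMeasure hτ _)

lemma measurable_coe_output_apply (p : Protocol X B P N) (i : Fin d) :
    Measurable fun x => (p.output x : EuclideanSpace ℝ (Fin d)) i := by
  have h : Measurable fun x => (p.output x : EuclideanSpace ℝ (Fin d)) :=
    measurable_subtype_coe.comp p.measurable_output
  fun_prop

section Power

variable (p : Protocol X B P N) (t : Fin p.T) {g : EuclideanSpace ℝ (Fin d)}
  {w : ℝ≥0} {s : S}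

lemma measurable_norm_encoder_sq (g : EuclideanSpace ℝ (Fin d)) :
    Measurable fun u : Fin p.T → p.R => ‖p.encoder (g, u t)‖ ^ 2 :=
  (p.measurable_encoder.comp
    (measurable_prodMk_left.comp (measurable_pi_apply t))).norm.pow_const 2

lemma lintegral_norm_encoder_sq_le (hg : ‖g‖ ^ 2 ≤ B ^ 2) :
    ∫⁻ u, ENNReal.ofReal (‖p.encoder (g, u t)‖ ^ 2) ∂p.randLaw ≤ ENNReal.ofReal (p.ℓ * P) := by
  have henorm : ∀ {m : ℕ} (x : EuclideanSpace ℝ (Fin m)),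
      ‖x‖ₑ ^ 2 = ENNReal.ofReal (‖x‖ ^ 2) := fun x => by
    rw [← ofReal_norm, ENNReal.ofReal_pow (norm_nonneg _)]
  have hpower := p.power t (Measure.dirac g) inferInstance (by
    rw [lintegral_dirac, henorm]
    exact ENNReal.ofReal_le_ofReal hg)
  have hm : Measurable fun ρ : p.R => ‖p.encoder (g, ρ)‖ₑ ^ 2 :=
    (p.measurable_encoder.comp measurable_prodMk_left).enorm.pow_const 2
  rw [lintegral_dirac, lintegral_map hm (measurable_pi_apply t)] at hpower
  simpa only [henorm] using hpower

lemma integrable_norm_encoder_sq (hg : ‖g‖ ^ 2 ≤ B ^ 2) :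
    Integrable (fun u => ‖p.encoder (g, u t)‖ ^ 2) p.randLaw :=
  ⟨(p.measurable_norm_encoder_sq t g).aestronglyMeasurable,
    (hasFiniteIntegral_iff_ofReal (.of_forall fun _ => sq_nonneg _)).2
      ((p.lintegral_norm_encoder_sq_le t hg).trans_lt ENNReal.ofReal_lt_top)⟩

lemma integral_norm_encoder_sq_le (hP : 0 ≤ P) (hg : ‖g‖ ^ 2 ≤ B ^ 2) :
    ∫ u, ‖p.encoder (g, u t)‖ ^ 2 ∂p.randLaw ≤ p.ℓ * P := by
  rw [integral_eq_lintegral_of_nonneg_ae (.of_forall fun _ => sq_nonneg _)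
    (p.measurable_norm_encoder_sq t g).aestronglyMeasurable]
  exact ENNReal.toReal_le_of_le_ofReal (by positivity) (p.lintegral_norm_encoder_sq_le t hg)

lemma relEntropy_outputKernel (hτ : τ ≠ 0) (hw : w ≠ 0) (ρ : p.R) :
    relEntropy volume (p.outputKernel τ c s ρ) (gaussDensity w 0) =
      p.ℓ / 2 * Real.log (w / τ) + (‖p.encoder (c s, ρ)‖ ^ 2 - p.ℓ * (w - τ)) / (2 * w) := by
  rw [outputKernel, relEntropy_gaussDensity hτ hw, EuclideanSpace.norm_sq_eq]
  simp only [Pi.zero_apply, sub_zero, Fintype.card_fin, Real.norm_eq_abs, sq_abs]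

lemma integrable_relEntropy_outputKernel (hτ : τ ≠ 0) (hw : w ≠ 0) (hc : ‖c s‖ ^ 2 ≤ B ^ 2) :
    Integrable (fun u => relEntropy volume (p.outputKernel τ c s (u t)) (gaussDensity w 0))
      p.randLaw := by
  simp only [p.relEntropy_outputKernel hτ hw]
  exact (integrable_const _).add
    (((p.integrable_norm_encoder_sq t hc).sub (integrable_const _)).div_const _)

-- The reference law is the Gaussian whose variance is the largest average power of an output.
lemma integral_relEntropy_outputKernel_le (hτ : τ ≠ 0) (hP : 0 ≤ P) (hc : ‖c s‖ ^ 2 ≤ B ^ 2) :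
    ∫ u, relEntropy volume (p.outputKernel τ c s (u t)) (gaussDensity (τ + P.toNNReal) 0)
      ∂p.randLaw ≤ p.ℓ / 2 * Real.log (1 + P / τ) := by
  have hτ0 : (0 : ℝ) < τ := NNReal.coe_pos.2 (pos_iff_ne_zero.2 hτ)
  have hsub : Integrable (fun u => ‖p.encoder (c s, u t)‖ ^ 2 - p.ℓ * P) p.randLaw :=
    (p.integrable_norm_encoder_sq t hc).sub (integrable_const _)
  simp only [p.relEntropy_outputKernel hτ (w := τ + P.toNNReal) (by positivity), NNReal.coe_add,
    Real.coe_toNNReal P hP, add_sub_cancel_left]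
  rw [integral_add (integrable_const _) (hsub.div_const _), integral_div,
    integral_sub (p.integrable_norm_encoder_sq t hc) (integrable_const _), integral_const,
    integral_const, probReal_univ, one_smul, one_smul, add_div, div_self hτ0.ne']
  have hpower := p.integral_norm_encoder_sq_le t hP hc
  linarith [div_nonpos_of_nonpos_of_nonneg (sub_nonpos.2 hpower)
    (by positivity : 0 ≤ 2 * ((τ : ℝ) + P))]

end Power

section Information

variable {δ : ℝ} {c : (Fin d → Bool) → EuclideanSpace ℝ (Fin d)}

/-- The joint density of the public randomness and of the channel outputs, when the oracle answers
each query by `c s`, with a fresh sign vector `s` that has the weights `cubeWeight δ v`. -/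
noncomputable def signTranscript (p : Protocol X B P N) (τ : ℝ≥0)
    (c : (Fin d → Bool) → EuclideanSpace ℝ (Fin d)) (δ : ℝ) (v : Fin d → Bool) :
    (Fin p.T → p.R) × (Fin p.T → Fin p.ℓ → ℝ) → ℝ :=
  transcriptDensity (cubeWeight δ v) (p.outputKernel τ c)

lemma isPosDensity_signTranscript (p : Protocol X B P N) (hτ : τ ≠ 0) (h0 : 0 ≤ δ)
    (h1 : δ ≤ 1 / 2) (v : Fin d → Bool) :
    IsPosDensity (p.randLaw.prod (Measure.pi fun _ => volume)) (p.signTranscript τ c δ v) :=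
  isPosDensity_transcriptDensity (cubeWeight_mem_stdSimplex h0 h1 v)
    (p.isPosDensity_outputKernel hτ) p.measurable_outputKernel

lemma sum_hellingerSq_signTranscript_le_card (p : Protocol X B P N) (hτ : τ ≠ 0) (h0 : 0 ≤ δ)
    (h1 : δ ≤ 1 / 2) (v : Fin d → Bool) :
    ∑ i, hellingerSq (p.randLaw.prod (Measure.pi fun _ => volume)) (p.signTranscript τ c δ v)
      (p.signTranscript τ c δ (flipAt i v)) ≤ 16 * δ ^ 2 * (p.T * d) := by
  refine (sum_hellingerSq_transcriptDensity_le (cubeWeight_mem_stdSimplex h0 h1 v)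
    (fun i => cubeWeight_mem_stdSimplex h0 h1 (flipAt i v)) (p.isPosDensity_outputKernel hτ)
    p.measurable_outputKernel (fun ρ => sum_hellingerSq_flipAt_le_card h0 h1 v
      fun s => p.isPosDensity_outputKernel hτ s ρ) fun _ => integrable_const _).trans_eq ?_
  simp only [integral_const, probReal_univ, one_smul, Finset.sum_const, Finset.card_univ,
    Fintype.card_fin, nsmul_eq_mul]
  ring

lemma sum_hellingerSq_signTranscript_le_capacity (p : Protocol X B P N) (hτ : τ ≠ 0)
    (h0 : 0 < δ) (h1 : δ ≤ 1 / 2) (hP : 0 ≤ P) (hc : ∀ s, ‖c s‖ ^ 2 ≤ B ^ 2)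
    (v : Fin d → Bool) :
    ∑ i, hellingerSq (p.randLaw.prod (Measure.pi fun _ => volume)) (p.signTranscript τ c δ v)
      (p.signTranscript τ c δ (flipAt i v)) ≤
        16 * δ ^ 2 * (p.T * (p.ℓ * Real.log (1 + P / τ))) := by
  have hw : τ + P.toNNReal ≠ 0 := by positivity
  have hcube := cubeWeight_mem_stdSimplex h0.le h1 v
  have hterm : ∀ t s, Integrable (fun u => cubeWeight δ v s * relEntropy volume
      (p.outputKernel τ c s (u t)) (gaussDensity (τ + P.toNNReal) 0)) p.randLaw := fun t s =>
    (p.integrable_relEntropy_outputKernel t hτ hw (hc s)).const_mul _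
  have hentropy : ∀ t, ∫ u, ∑ s, cubeWeight δ v s * relEntropy volume
      (p.outputKernel τ c s (u t)) (gaussDensity (τ + P.toNNReal) 0) ∂p.randLaw ≤
      p.ℓ / 2 * Real.log (1 + P / τ) := fun t => by
    rw [integral_finsetSum _ fun s _ => hterm t s]
    simp only [integral_const_mul]
    calc _ ≤ ∑ s, cubeWeight δ v s * (p.ℓ / 2 * Real.log (1 + P / τ)) :=
          Finset.sum_le_sum fun s _ => mul_le_mul_of_nonneg_left
            (p.integral_relEntropy_outputKernel_le t hτ hP (hc s)) (hcube.1 s)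
      _ = p.ℓ / 2 * Real.log (1 + P / τ) := by rw [← Finset.sum_mul, hcube.2, one_mul]
  calc _ ≤ ∑ t, ∫ u, 32 * δ ^ 2 * ∑ s, cubeWeight δ v s * relEntropy volume
          (p.outputKernel τ c s (u t)) (gaussDensity (τ + P.toNNReal) 0) ∂p.randLaw :=
        sum_hellingerSq_transcriptDensity_le hcube
          (fun i => cubeWeight_mem_stdSimplex h0.le h1 (flipAt i v))
          (p.isPosDensity_outputKernel hτ) p.measurable_outputKernel
          (fun ρ => sum_hellingerSq_flipAt_le_relEntropy h0 h1 v
            (fun s => p.isPosDensity_outputKernel hτ s ρ) (isPosDensity_gaussDensity hw 0)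
            fun s => integrable_entropyIntegrand_gaussDensity hτ hw _ 0)
          fun t => (integrable_finsetSum _ fun s _ => hterm t s).const_mul _
    _ ≤ ∑ _t : Fin p.T, 32 * δ ^ 2 * (p.ℓ / 2 * Real.log (1 + P / τ)) := by
        simp only [integral_const_mul]
        exact Finset.sum_le_sum fun t _ => mul_le_mul_of_nonneg_left (hentropy t) (by positivity)
    _ = _ := by
        rw [Finset.sum_const, Finset.card_univ, Fintype.card_fin, nsmul_eq_mul]
        ring

end Information

end Protocol

end Run

section CubeOracle

variable {d : ℕ} {r D a b δ : ℝ}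

/-- The cube with sides of length `2 * r`, centred at the origin. -/
def cube (d : ℕ) (r : ℝ) : Set (EuclideanSpace ℝ (Fin d)) := {x | ∀ i, |x i| ≤ r}

lemma isClosed_cube (d : ℕ) (r : ℝ) : IsClosed (cube d r) := by
  simp only [cube, Set.ofPred_forall]
  exact isClosed_iInter fun i => isClosed_le (by fun_prop) continuous_const

lemma convex_cube (d : ℕ) (r : ℝ) : Convex ℝ (cube d r) := by
  intro x hx y hy a b ha hb hab i
  calc |(a • x + b • y) i| ≤ |a * x i| + |b * y i| := abs_add_le _ _
    _ = a * |x i| + b * |y i| := by rw [abs_mul, abs_mul, abs_of_nonneg ha, abs_of_nonneg hb]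
    _ ≤ a * r + b * r := by
        gcongr
        exacts [hx i, hy i]
    _ = r := by rw [← add_mul, hab, one_mul]

lemma isFeasibleSet_cube (hr : 0 ≤ r) (hD : 0 ≤ D) (h : d * (2 * r) ^ 2 ≤ D ^ 2) :
    IsFeasibleSet D (cube d r) where
  nonempty := ⟨0, fun _ => abs_zero.trans_le hr⟩
  closed := isClosed_cube d r
  convex := convex_cube d r
  diam_le x hx y hy := by
    refine le_of_sq_le_sq ?_ hD
    rw [EuclideanSpace.norm_sq_eq]
    have hcoord : ∀ i, ‖(x - y) i‖ ^ 2 ≤ (2 * r) ^ 2 := fun i => by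
      refine pow_le_pow_left₀ (norm_nonneg _) ?_ 2
      calc |x i - y i| ≤ |x i| + |y i| := abs_sub _ _
        _ ≤ 2 * r := by linarith [hx i, hy i]
    calc ∑ i, ‖(x - y) i‖ ^ 2 ≤ ∑ _i : Fin d, (2 * r) ^ 2 := Finset.sum_le_sum fun i _ => hcoord i
      _ ≤ D ^ 2 := by
        rwa [Finset.sum_const, Finset.card_univ, Fintype.card_fin, nsmul_eq_mul]

/-- The vector with entries of modulus `a` and signs opposite to `s`. -/
noncomputable def signVector (a : ℝ) (s : Fin d → Bool) : EuclideanSpace ℝ (Fin d) :=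
  WithLp.toLp 2 fun i => -(a * boolSign (s i))

lemma norm_signVector_sq (a : ℝ) (s : Fin d → Bool) : ‖signVector a s‖ ^ 2 = d * a ^ 2 := by
  simp only [EuclideanSpace.norm_sq_eq, signVector, norm_neg, norm_mul, Real.norm_eq_abs,
    abs_boolSign, mul_one, sq_abs, Finset.sum_const, Finset.card_univ, Fintype.card_fin,
    nsmul_eq_mul]

lemma inner_signVector (a : ℝ) (s : Fin d → Bool) (x : EuclideanSpace ℝ (Fin d)) :
    inner ℝ (signVector a s) x = -(a * ∑ i, boolSign (s i) * x i) := by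
  rw [PiLp.inner_apply, Finset.mul_sum, ← Finset.sum_neg_distrib]
  refine Finset.sum_congr rfl fun i _ => ?_
  simp only [signVector, RCLike.inner_apply, conj_trivial]
  ring

lemma isLeast_inner_signVector_cube (ha : 0 ≤ a) (hr : 0 ≤ r) (v : Fin d → Bool) :
    IsLeast (Set.range fun x : cube d r => inner ℝ (signVector a v) x.1) (-(a * (d * r))) := by
  have hsum : ∑ _i : Fin d, r = d * r := by
    rw [Finset.sum_const, Finset.card_univ, Fintype.card_fin, nsmul_eq_mul]
  constructor
  · have hmem : signVector (-r) v ∈ cube d r := fun i => by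
      simp only [signVector, abs_neg, abs_mul, abs_boolSign, mul_one, abs_of_nonneg hr, le_refl]
    refine ⟨⟨_, hmem⟩, ?_⟩
    have hcoord : ∀ i, boolSign (v i) * signVector (-r) v i = r := fun i => by
      have hsq : boolSign (v i) * boolSign (v i) = 1 := by
        rw [← abs_mul_abs_self, abs_boolSign, one_mul]
      calc boolSign (v i) * -(-r * boolSign (v i)) = r * (boolSign (v i) * boolSign (v i)) := by
            ring
        _ = r := by rw [hsq, mul_one]
    simp only [inner_signVector, hcoord, hsum]
  · rintro _ ⟨x, rfl⟩
    simp only [inner_signVector]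
    refine neg_le_neg (mul_le_mul_of_nonneg_left ?_ ha)
    rw [← hsum]
    refine Finset.sum_le_sum fun i _ => (le_abs_self _).trans ?_
    rw [abs_mul, abs_boolSign, one_mul]
    exact x.2 i

/-- The distribution on sign vectors with the weights `cubeWeight δ v`. -/
noncomputable def cubePMF (h0 : 0 ≤ δ) (h1 : δ ≤ 1 / 2) (v : Fin d → Bool) :
    PMF (Fin d → Bool) :=
  PMF.ofFintype (fun s => ENNReal.ofReal (cubeWeight δ v s)) <| by
    obtain ⟨hnonneg, hsum⟩ := cubeWeight_mem_stdSimplex h0 h1 v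
    rw [← ENNReal.ofReal_sum_of_nonneg fun s _ => hnonneg s, hsum, ENNReal.ofReal_one]

lemma cubePMF_toMeasure_real_singleton (h0 : 0 ≤ δ) (h1 : δ ≤ 1 / 2) (v s : Fin d → Bool) :
    (cubePMF h0 h1 v).toMeasure.real {s} = cubeWeight δ v s := by
  rw [measureReal_def, PMF.toMeasure_apply_singleton _ _ (measurableSet_singleton s), cubePMF,
    PMF.ofFintype_apply, ENNReal.toReal_ofReal ((cubeWeight_mem_stdSimplex h0 h1 v).1 s)]

lemma integral_signVector_cubePMF (h0 : 0 ≤ δ) (h1 : δ ≤ 1 / 2) (b : ℝ) (v : Fin d → Bool) :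
    ∫ s, signVector b s ∂(cubePMF h0 h1 v).toMeasure = signVector (δ * b) v := by
  rw [integral_fintype .of_finite]
  ext i
  simp only [cubePMF_toMeasure_real_singleton, signVector, WithLp.ofLp_sum, Finset.sum_apply,
    PiLp.smul_apply, smul_eq_mul]
  calc ∑ s, cubeWeight δ v s * -(b * boolSign (s i))
      = -(b * ∑ s, cubeWeight δ v s * boolSign (s i)) := by
        rw [Finset.mul_sum, ← Finset.sum_neg_distrib]
        exact Finset.sum_congr rfl fun s _ => by ring
    _ = -(δ * b * boolSign (v i)) := by
        rw [sum_cubeWeight_mul_boolSign h0 h1]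
        ring

/-- The linear function with gradient `signVector (δ * b) v` on the cube, with the oracle that
answers every query by `signVector b s`, where `s` is drawn from `cubePMF`. -/
noncomputable def cubeOracle (r : ℝ) {B : ℝ} (h0 : 0 ≤ δ) (h1 : δ ≤ 1 / 2)
    (hb : d * b ^ 2 ≤ B ^ 2) (v : Fin d → Bool) : FunctionOracle (cube d r) B where
  f x := inner ℝ (signVector (δ * b) v) x
  convexOn := (innerₛₗ ℝ (signVector (δ * b) v)).convexOn (convex_cube d r)
  Seed := Fin d → Bool
  seedLaw := (cubePMF h0 h1 v).toMeasure
  grad x := signVector b x.2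
  measurable_grad := (measurable_of_finite (signVector b)).comp measurable_snd
  unbiased x y _ := by
    rw [integral_signVector_cubePMF, inner_sub_right, add_sub_cancel]
  meanSquare _ := by
    simp only [← ofReal_norm, ← ENNReal.ofReal_pow (norm_nonneg _), norm_signVector_sq,
      lintegral_const, measure_univ, mul_one]
    exact ENNReal.ofReal_le_ofReal hb

instance (h0 : 0 ≤ δ) (h1 : δ ≤ 1 / 2) {B : ℝ} (hb : d * b ^ 2 ≤ B ^ 2) (v : Fin d → Bool) :
    Fintype (cubeOracle r h0 h1 hb v).Seed :=
  inferInstanceAs (Fintype (Fin d → Bool))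

instance (h0 : 0 ≤ δ) (h1 : δ ≤ 1 / 2) {B : ℝ} (hb : d * b ^ 2 ≤ B ^ 2) (v : Fin d → Bool) :
    MeasurableSingletonClass (cubeOracle r h0 h1 hb v).Seed :=
  inferInstanceAs (MeasurableSingletonClass (Fin d → Bool))

end CubeOracle

section Error

variable {d N : ℕ} {B P : ℝ}

lemma Protocol.integral_finalPoint {X : Set (EuclideanSpace ℝ (Fin d))} (p : Protocol X B P N)
    (O : FunctionOracle X B) [Fintype O.Seed] [MeasurableSingletonClass O.Seed]
    {g : O.Seed → EuclideanSpace ℝ (Fin d)} (hg : ∀ x w, O.grad (x, w) = g w) {σ : ℝ}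
    (hσ : 0 < σ) {F : X → ℝ} (hF : Measurable F) :
    ∫ ω, F (finalPoint p O ω) ∂runLaw p O σ =
      ∫ x, transcriptDensity (fun w => O.seedLaw.real {w})
        (p.outputKernel (σ ^ 2).toNNReal g) x * F (p.output x)
        ∂p.randLaw.prod (Measure.pi fun _ => volume) := by
  have hτ : (σ ^ 2).toNNReal ≠ 0 := (Real.toNNReal_pos.2 (by positivity)).ne'
  have hdensity := isPosDensity_transcriptDensity (μ := p.randLaw)
    (measureReal_singleton_mem_stdSimplex O.seedLaw)
    (p.isPosDensity_outputKernel (c := g) hτ) p.measurable_outputKernel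
  have hlaw := p.map_runLaw_eq_densityMeasure O hg hσ
  have hrun := AEMeasurable.of_map_ne_zero (hlaw ▸ hdensity.isProbabilityMeasure.ne_zero)
  rw [← hdensity.integral_densityMeasure fun x => F (p.output x), ← hlaw]
  exact (integral_map hrun (hF.comp p.measurable_output).aestronglyMeasurable).symm

variable {r b δ σ : ℝ}

lemma Protocol.integral_finalPoint_cubeOracle (p : Protocol (cube d r) B P N) (hσ : 0 < σ)
    (h0 : 0 ≤ δ) (h1 : δ ≤ 1 / 2) (hb : d * b ^ 2 ≤ B ^ 2) (v : Fin d → Bool)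
    {F : cube d r → ℝ} (hF : Measurable F) :
    ∫ ω, F (finalPoint p (cubeOracle r h0 h1 hb v) ω) ∂runLaw p (cubeOracle r h0 h1 hb v) σ =
      ∫ x, p.signTranscript (σ ^ 2).toNNReal (signVector b) δ v x * F (p.output x)
        ∂p.randLaw.prod (Measure.pi fun _ => volume) := by
  have hweight : (fun s => (cubeOracle (B := B) r h0 h1 hb v).seedLaw.real {s}) =
      cubeWeight δ v := funext (cubePMF_toMeasure_real_singleton h0 h1 v)
  rw [p.integral_finalPoint _ (g := signVector b) (fun _ _ => rfl) hσ hF, hweight]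
  rfl

lemma Protocol.convergenceError_cubeOracle (p : Protocol (cube d r) B P N) (hσ : 0 < σ)
    (h0 : 0 ≤ δ) (h1 : δ ≤ 1 / 2) (hb0 : 0 ≤ b) (hb : d * b ^ 2 ≤ B ^ 2) (hr : 0 ≤ r)
    (v : Fin d → Bool) :
    convergenceError p (cubeOracle r h0 h1 hb v) σ = δ * b * (d * r - ∑ i, boolSign (v i) *
      ∫ x, p.signTranscript (σ ^ 2).toNNReal (signVector b) δ v x * (p.output x).1 i
        ∂p.randLaw.prod (Measure.pi fun _ => volume)) := by
  have hτ : (σ ^ 2).toNNReal ≠ 0 := (Real.toNNReal_pos.2 (by positivity)).ne'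
  have hint : ∀ i, Integrable (fun x => boolSign (v i) *
      (p.signTranscript (σ ^ 2).toNNReal (signVector b) δ v x * (p.output x).1 i))
      (p.randLaw.prod (Measure.pi fun _ => volume)) := fun i =>
    ((p.isPosDensity_signTranscript hτ h0 h1 v).integrable.mul_bdd
      (p.measurable_coe_output_apply i).aestronglyMeasurable
      (.of_forall fun x => (p.output x).2 i)).const_mul _
  have hmin : ⨅ x : cube d r, inner ℝ (signVector (δ * b) v) x.1 = -(δ * b * (d * r)) :=
    (isLeast_inner_signVector_cube (mul_nonneg h0 hb0) hr v).csInf_eq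
  have hmean := p.integral_finalPoint_cubeOracle hσ h0 h1 hb v
    (F := fun x => inner ℝ (signVector (δ * b) v) x.1) (by fun_prop)
  have hsum : ∀ x, p.signTranscript (σ ^ 2).toNNReal (signVector b) δ v x *
      inner ℝ (signVector (δ * b) v) (p.output x).1 = -(δ * b * ∑ i, boolSign (v i) *
        (p.signTranscript (σ ^ 2).toNNReal (signVector b) δ v x * (p.output x).1 i)) := fun x => by
    rw [inner_signVector, mul_neg, mul_left_comm, Finset.mul_sum]
    simp only [mul_left_comm]
  simp only [hsum, integral_neg, integral_const_mul] at hmean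
  rw [integral_finsetSum _ fun i _ => hint i] at hmean
  simp only [integral_const_mul] at hmean
  refine (congrArg₂ (· - ·) hmean hmin).trans ?_
  ring

end Error

section Conclusion

lemma min_natCast_mul_le {a b : ℝ} (ha : 0 ≤ a) (n : ℕ) : min a (n * b) ≤ n * min a b := by
  rcases Nat.eq_zero_or_pos n with rfl | hn
  · simp only [Nat.cast_zero, zero_mul, min_le_right]
  · rw [mul_min_of_nonneg _ _ n.cast_nonneg]
    exact min_le_min_right _ (le_mul_of_one_le_left ha (Nat.one_le_cast.2 hn))

lemma log_le_logb_two {x : ℝ} (hx : 1 ≤ x) : Real.log x ≤ Real.logb 2 x :=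
  le_div_self (Real.log_nonneg hx) (Real.log_pos one_lt_two)
    (Real.log_two_lt_d9.le.trans (by norm_num))

variable {d N : ℕ} {D B P : ℝ} {τ : ℝ≥0} {σ δ r b e : ℝ}

lemma Protocol.T_mul_min_le {X : Set (EuclideanSpace ℝ (Fin d))} (p : Protocol X B P N) {x : ℝ}
    (hx : 1 ≤ x) :
    p.T * min (d : ℝ) (p.ℓ * Real.log x) ≤ 2 * (N * min (d : ℝ) (1 / 2 * Real.logb 2 x)) := by
  have hd : (0 : ℝ) ≤ d := d.cast_nonneg
  have hmin : 0 ≤ min (d : ℝ) (Real.log x) := le_min hd (Real.log_nonneg hx)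
  have huses : (p.ℓ * p.T : ℝ) ≤ N := mod_cast p.channelUses
  calc p.T * min (d : ℝ) (p.ℓ * Real.log x) ≤ p.T * (p.ℓ * min (d : ℝ) (Real.log x)) := by
        gcongr
        exact min_natCast_mul_le hd p.ℓ
    _ = p.ℓ * p.T * min (d : ℝ) (Real.log x) := by ring
    _ ≤ N * min (d : ℝ) (Real.log x) := by gcongr
    _ ≤ N * min (2 * (d : ℝ)) (2 * (1 / 2 * Real.logb 2 x)) := by
        gcongr
        · linarith
        · linarith [log_le_logb_two hx]
    _ = 2 * (N * min (d : ℝ) (1 / 2 * Real.logb 2 x)) := by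
        rw [← mul_min_of_nonneg _ _ zero_le_two, mul_left_comm]

lemma Protocol.sum_hellingerSq_signTranscript_le {X : Set (EuclideanSpace ℝ (Fin d))}
    (p : Protocol X B P N) {c : (Fin d → Bool) → EuclideanSpace ℝ (Fin d)} (hτ : τ ≠ 0)
    (h0 : 0 < δ) (h1 : δ ≤ 1 / 2) (hP : 0 ≤ P) (hc : ∀ s, ‖c s‖ ^ 2 ≤ B ^ 2)
    (v : Fin d → Bool) :
    ∑ i, hellingerSq (p.randLaw.prod (Measure.pi fun _ => volume)) (p.signTranscript τ c δ v)
        (p.signTranscript τ c δ (flipAt i v)) ≤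
      32 * δ ^ 2 * (N * min (d : ℝ) (1 / 2 * Real.logb 2 (1 + P / τ))) := by
  have hsnr : 1 ≤ 1 + P / τ := le_add_of_nonneg_right (by positivity)
  calc _ ≤ 16 * δ ^ 2 * (p.T * min (d : ℝ) (p.ℓ * Real.log (1 + P / τ))) := by
        rw [mul_min_of_nonneg _ _ (Nat.cast_nonneg p.T), mul_min_of_nonneg _ _ (by positivity)]
        exact le_min (p.sum_hellingerSq_signTranscript_le_card hτ h0.le h1 v)
          (p.sum_hellingerSq_signTranscript_le_capacity hτ h0 h1 hP hc v)
    _ ≤ 16 * δ ^ 2 * (2 * (N * min (d : ℝ) (1 / 2 * Real.logb 2 (1 + P / τ)))) := by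
        exact mul_le_mul_of_nonneg_left (p.T_mul_min_le hsnr) (by positivity)
    _ = _ := by ring

lemma Protocol.exists_cubeOracle_le_convergenceError (p : Protocol (cube d r) B P N)
    (hP : 0 ≤ P) (hσ : 0 < σ) (h0 : 0 < δ) (h1 : δ ≤ 1 / 2)
    (hδ : 64 * δ ^ 2 * (N * min (d : ℝ) (1 / 2 * Real.logb 2 (1 + P / σ ^ 2))) ≤ d)
    (hb0 : 0 ≤ b) (hb : d * b ^ 2 ≤ B ^ 2) (hr : 0 ≤ r) :
    ∃ v, δ * b * (d * r) / 4 ≤ convergenceError p (cubeOracle r h0.le h1 hb v) σ := by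
  have hτ : (σ ^ 2).toNNReal ≠ 0 := (Real.toNNReal_pos.2 (by positivity)).ne'
  have hH : ∀ v, ∑ i, hellingerSq (p.randLaw.prod (Measure.pi fun _ => volume))
      (p.signTranscript (σ ^ 2).toNNReal (signVector b) δ v)
      (p.signTranscript (σ ^ 2).toNNReal (signVector b) δ (flipAt i v)) ≤ d / 2 := fun v => by
    have h := p.sum_hellingerSq_signTranscript_le hτ h0 h1 hP
      (fun s => (norm_signVector_sq b s).trans_le hb) v
    rw [Real.coe_toNNReal _ (sq_nonneg σ)] at h
    linarith
  obtain ⟨v, hv⟩ := exists_sum_boolSign_mul_integral_le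
    (p.isPosDensity_signTranscript hτ h0.le h1) p.measurable_coe_output_apply hr
    (fun i x => (p.output x).2 i) hH
  rw [Fintype.card_fin] at hv
  refine ⟨v, ?_⟩
  rw [p.convergenceError_cubeOracle hσ h0.le h1 hb0 hb hr, mul_div_assoc]
  exact mul_le_mul_of_nonneg_left (by linarith) (mul_nonneg h0.le hb0)

lemma le_minmaxError {X : Set (EuclideanSpace ℝ (Fin d))} (hX : IsFeasibleSet D X)
    (h : ∀ p : Protocol X B P N, ∃ O, e ≤ convergenceError p O σ) :
    (e : EReal) ≤ minmaxError d D B P σ N :=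
  le_iSup₂_of_le X hX <| le_iInf fun p =>
    let ⟨O, hO⟩ := h p
    le_iSup_of_le O (EReal.coe_le_coe_iff.2 hO)

theorem mul_le_minmaxError (hd : 1 ≤ d) (hD : 0 ≤ D) (hB : 0 ≤ B) (hP : 0 ≤ P) (hσ : 0 < σ)
    (h0 : 0 < δ) (h1 : δ ≤ 1 / 2)
    (hδ : 64 * δ ^ 2 * (N * min (d : ℝ) (1 / 2 * Real.logb 2 (1 + P / σ ^ 2))) ≤ d) :
    ((D * B * δ / 8 : ℝ) : EReal) ≤ minmaxError d D B P σ N := by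
  have hd0 : (0 : ℝ) < d := Nat.cast_pos.2 hd
  have hsq : √(d : ℝ) ^ 2 = d := Real.sq_sqrt hd0.le
  have hside : d * (2 * (D / √d / 2)) ^ 2 ≤ D ^ 2 := by
    rw [mul_div_cancel₀ _ two_ne_zero, div_pow, hsq, mul_div_cancel₀ _ hd0.ne']
  have hb : d * (B / √d) ^ 2 ≤ B ^ 2 := by
    rw [div_pow, hsq, mul_div_cancel₀ _ hd0.ne']
  have herror : D * B * δ / 8 = δ * (B / √d) * (d * (D / √d / 2)) / 4 := by
    field_simp
    rw [hsq]
    ring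
  refine le_minmaxError (isFeasibleSet_cube (by positivity) hD hside) fun p => ?_
  obtain ⟨v, hv⟩ := p.exists_cubeOracle_le_convergenceError hP hσ h0 h1 hδ (by positivity) hb
    (by positivity)
  exact ⟨_, herror.trans_le hv⟩

theorem mul_sqrt_le_minmaxError (hd : 1 ≤ d) (hD : 0 ≤ D) (hB : 0 ≤ B) (hP : 0 ≤ P) (hσ : 0 < σ)
    (hN : (d : ℝ) / 2 ≤ N * min (d : ℝ) (1 / 2 * Real.logb 2 (1 + P / σ ^ 2))) :
    ((D * B / 64 * √(d / (N * min (d : ℝ) (1 / 2 * Real.logb 2 (1 + P / σ ^ 2)))) : ℝ) : EReal) ≤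
      minmaxError d D B P σ N := by
  have hd0 : (0 : ℝ) < d := Nat.cast_pos.2 hd
  set M := N * min (d : ℝ) (1 / 2 * Real.logb 2 (1 + P / σ ^ 2))
  have hM0 : 0 < M := (half_pos hd0).trans_le hN
  have hδ : 64 * (√(d / M) / 8) ^ 2 * M = d := by
    rw [div_pow, Real.sq_sqrt (by positivity)]
    field_simp
    norm_num
  have hδ1 : √(d / M) / 8 ≤ 1 / 2 := by
    rw [div_le_iff₀ (by norm_num), Real.sqrt_le_left (by norm_num), div_le_iff₀ hM0]
    linarith
  rw [show D * B / 64 * √(d / M) = D * B * (√(d / M) / 8) / 8 by ring]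
  exact mul_le_minmaxError hd hD hB hP hσ (by positivity) hδ1 hδ.le

end Conclusion

end OverTheAir

theorem theorem1 :
    ∃ c : ℝ, 0 < c ∧ c < 1 ∧
      ∀ (d : ℕ) (D B P σ : ℝ) (N : ℕ), 1 ≤ d → 0 < D → 0 < B → 0 < P → 0 < σ →
        (d : ℝ) / Real.logb 2 (1 + P / σ ^ 2) ≤ N →
        ((c * D * B / √(N : ℝ) *
            √((d : ℝ) / min (d : ℝ) (1 / 2 * Real.logb 2 (1 + P / σ ^ 2))) : ℝ) : EReal)
          ≤ OverTheAir.minmaxError d D B P σ N := by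
  refine ⟨1 / 64, by norm_num, by norm_num, fun d D B P σ N hd hD hB hP hσ hN => ?_⟩
  have hd0 : (0 : ℝ) < d := Nat.cast_pos.2 hd
  have hL : 0 < Real.logb 2 (1 + P / σ ^ 2) :=
    Real.logb_pos one_lt_two (lt_add_of_pos_right 1 (by positivity))
  have hN1 : (1 : ℝ) ≤ N := Nat.one_le_cast.2 (Nat.cast_pos.1 ((div_pos hd0 hL).trans_le hN))
  have hmin : (d : ℝ) / 2 ≤ N * min (d : ℝ) (1 / 2 * Real.logb 2 (1 + P / σ ^ 2)) := by
    rw [mul_min_of_nonneg _ _ N.cast_nonneg]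
    exact le_min (by nlinarith) (by linarith [(div_le_iff₀ hL).1 hN])
  have hsplit : ∀ m : ℝ, 1 / 64 * D * B / √N * √(d / m) = D * B / 64 * √(d / (N * m)) := fun m => by
    rw [mul_comm (N : ℝ), ← div_div, Real.sqrt_div' _ N.cast_nonneg]
    ring
  rw [hsplit]
  exact OverTheAir.mul_sqrt_le_minmaxError hd hD.le hB.le hP.le hσ hmin
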